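/- Let $M$ be a complete oriented Riemannian $n$-manifold (smooth, without boundary, second countable), let $1<p<\infty$, $p'=\frac{p}{p-1}$, and let $0\le k\le n$. Let $L_p^k(M)$ be the Banach space of measurable $k$-forms $f$ (modulo a.e. equality) with $\|f\|_p^p=\int_M|f|^p\,dv<\infty$. The operators $d$ and $d^*$ are taken in the weak sense, tested against smooth compactly supported forms. Put $$\mathcal H_p^k(M)=\{h\in L_p^k(M): dh=0,\ d^*(|h|^{p-2}h)=0\},\qquad \mathcal E_p^k(M)=\{f\in L_p^k(M): d^*f=0,\ d(|f|^{p-2}f)=0\},$$ $$B_p^k(M)=\{d\beta\in L_p^k(M):\beta\in L_p^{k-1}(M)\},\qquad D_p^k(M)=\{d^*\beta\in L_p^k(M):\beta\in L_p^{k+1}(M)\},$$ $$T_p^k(M)=\overline{B_p^k(M)}/B_p^k(M),\qquad \mathcal T_p^k(M)=\overline{D_p^k(M)}/D_p^k(M),$$ with closures in $L_p$ and quotient seminorms ($B_p^0(M)=0$ and $D_p^n(M)=0$). Let $\ast$ be the Hodge star and $\ast_p h=\ast|h|^{p-2}h$. Then: 1. $\ast_p$ is a bijection from $\mathcal H_p^k(M)$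 onto $\mathcal H_{p'}^{n-k}(M)$, and it is norm preserving in the sense that $\|\ast_p h\|_{p'}^{p'}=\|h\|_p^p$. 2. $h\mapsto|h|^{p-2}h$ is a bijection from $\mathcal E_p^k(M)$ onto $\mathcal H_{p'}^k(M)$, and it is norm preserving in the sense that $\||h|^{p-2}h\|_{p'}^{p'}=\|h\|_p^p$. 3. $\ast$ is a linear isometry of $L_p^k(M)$ onto $L_p^{n-k}(M)$ that maps $B_p^k(M)$ onto $D_p^{n-k}(M)$ and $\overline{B_p^k(M)}$ onto $\overline{D_p^{n-k}(M)}$, and the induced map $[z]\mapsto[\ast z]$ is a linear isometric bijection from the torsion cohomology $T_p^k(M)$ onto the torsion homology $\mathcal T_p^{n-k}(M)$. -/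

import Mathlib

open Set Filter Topology MeasureTheory Bundle
open scoped Manifold ContDiff ENNReal NNReal

noncomputable section

instance fact_one_le_of_lt {p : ℝ} [h : Fact (1 < p)] : Fact (1 ≤ p) := ⟨h.out.le⟩

/-! ### Linear algebra of alternating forms on a Euclidean vector space -/

section LinearAlgebra

variable {V : Type*} [NormedAddCommGroup V] [InnerProductSpace ℝ V] [FiniteDimensional ℝ V]

/-- The inner product of two alternating `k`-forms on a Euclidean space: the sum of
`α(e_I) β(e_I)` over increasing multi-indices `I`, for an orthonormal basis `e`, written as
`1 / k!` times the sum over all multi-indices. -/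
def altInner {k : ℕ} (α β : V [⋀^Fin k]→ₗ[ℝ] ℝ) : ℝ :=
  (k.factorial : ℝ)⁻¹ * ∑ f : Fin k → Fin (Module.finrank ℝ V),
    α (fun i => stdOrthonormalBasis ℝ V (f i)) * β (fun i => stdOrthonormalBasis ℝ V (f i))

/-- The Euclidean norm of an alternating `k`-form. -/
def altNorm {k : ℕ} (α : V [⋀^Fin k]→ₗ[ℝ] ℝ) : ℝ := √(altInner α α)

/-- The exterior product of scalar alternating forms (a sum over shuffles). -/
def altWedge {W : Type*} [AddCommGroup W] [Module ℝ W] {k m : ℕ}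
    (α : W [⋀^Fin k]→ₗ[ℝ] ℝ) (β : W [⋀^Fin m]→ₗ[ℝ] ℝ) : W [⋀^Fin (k + m)]→ₗ[ℝ] ℝ :=
  ((LinearMap.mul' ℝ ℝ).compAlternatingMap (α.domCoprod β)).domDomCongr finSumFinEquiv

theorem append_update_right {W : Type*} {k l : ℕ} (u : Fin k → W) (v : Fin l → W) (i : Fin l)
    [DecidableEq (Fin l)] (z : W) :
    (Fin.append u (Function.update v i z) ∘ Fin.cast rfl : Fin (k + l) → W)
      = Function.update (Fin.append u v) (Fin.natAdd k i) z := by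
  funext j
  refine Fin.addCases (fun a => ?_) (fun a => ?_) j
  · have : Fin.castAdd l a ≠ Fin.natAdd k i := by
      intro h
      have := congrArg Fin.val h
      simp at this
      omega
    simp [Function.update_of_ne this]
  · by_cases hai : a = i
    · subst hai; simp
    · have : Fin.natAdd k a ≠ Fin.natAdd k i := by
        intro h; exact hai (by simpa using h)
      simp [Function.update_of_ne this, Function.update_of_ne hai]

/-- `freezeFirst τ u` is the alternating form `v ↦ τ(u₁, …, u_k, v₁, …, v_l)`. -/
def freezeFirst {W : Type*} [AddCommGroup W] [Module ℝ W] {k l n : ℕ} (h : k + l = n)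
    (τ : W [⋀^Fin n]→ₗ[ℝ] ℝ) (u : Fin k → W) : W [⋀^Fin l]→ₗ[ℝ] ℝ where
  toFun v := τ (Fin.append u v ∘ Fin.cast h.symm)
  map_update_add' := by
    intro _ v i x y
    subst h
    convert τ.map_update_add (Fin.append u v) (Fin.natAdd k i) x y using 2
    · exact append_update_right u v i _
    · congr 1; exact append_update_right u v i _
    · congr 1; exact append_update_right u v i _
  map_update_smul' := by
    intro _ v i c x
    subst h
    convert τ.map_update_smul (Fin.append u v) (Fin.natAdd k i) c x using 2
    · exact append_update_right u v i _
    · congr 1; exact append_update_right u v i _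
  map_eq_zero_of_eq' := by
    intro v i j hij hne
    subst h
    refine τ.map_eq_zero_of_eq _ (i := Fin.natAdd k i) (j := Fin.natAdd k j) ?_ ?_
    · simpa using hij
    · intro h; exact hne (by simpa using h)

/-- The Hodge star of a `k`-form with respect to a volume form `τ`:
`(⋆α)(v₁, …, v_l)` is the inner product of `α` with the `k`-form `τ(·, v₁, …, v_l)`,
that is `(1 / k!) ∑ α(e_{i₁}, …, e_{i_k}) τ(e_{i₁}, …, e_{i_k}, v₁, …, v_l)`. -/
def altStar {k l n : ℕ} (h : k + l = n) (τ : V [⋀^Fin n]→ₗ[ℝ] ℝ) :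
    (V [⋀^Fin k]→ₗ[ℝ] ℝ) →ₗ[ℝ] (V [⋀^Fin l]→ₗ[ℝ] ℝ) where
  toFun α := (k.factorial : ℝ)⁻¹ • ∑ f : Fin k → Fin (Module.finrank ℝ V),
    α (fun i => stdOrthonormalBasis ℝ V (f i)) •
      freezeFirst h τ (fun i => stdOrthonormalBasis ℝ V (f i))
  map_add' α β := by
    simp only [AlternatingMap.add_apply, add_smul, Finset.sum_add_distrib, smul_add]
  map_smul' c α := by
    simp only [AlternatingMap.smul_apply, smul_eq_mul, mul_smul, RingHom.id_apply,
      ← Finset.smul_sum]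
    rw [smul_comm]

theorem altInner_add_left {k : ℕ} (α β γ : V [⋀^Fin k]→ₗ[ℝ] ℝ) :
    altInner (α + β) γ = altInner α γ + altInner β γ := by
  simp only [altInner, AlternatingMap.add_apply, add_mul, Finset.sum_add_distrib, mul_add]

theorem altInner_smul_left {k : ℕ} (c : ℝ) (α γ : V [⋀^Fin k]→ₗ[ℝ] ℝ) :
    altInner (c • α) γ = c * altInner α γ := by
  simp only [altInner, AlternatingMap.smul_apply, smul_eq_mul, mul_assoc, ← Finset.mul_sum]
  ring

theorem altWedge_add_left {W : Type*} [AddCommGroup W] [Module ℝ W] {k m : ℕ}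
    (α α' : W [⋀^Fin k]→ₗ[ℝ] ℝ) (β : W [⋀^Fin m]→ₗ[ℝ] ℝ) :
    altWedge (α + α') β = altWedge α β + altWedge α' β := by
  ext v
  simp only [altWedge, ← AlternatingMap.domCoprod'_apply, TensorProduct.add_tmul, map_add]
  simp

theorem altWedge_smul_left {W : Type*} [AddCommGroup W] [Module ℝ W] {k m : ℕ}
    (c : ℝ) (α : W [⋀^Fin k]→ₗ[ℝ] ℝ) (β : W [⋀^Fin m]→ₗ[ℝ] ℝ) :
    altWedge (c • α) β = c • altWedge α β := by
  ext v
  simp only [altWedge, ← AlternatingMap.domCoprod'_apply, ← TensorProduct.smul_tmul', map_smul]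
  simp

/-- The coordinates of a form in the standard orthonormal basis, as a Euclidean vector. -/
def altCoord (k : ℕ) : (V [⋀^Fin k]→ₗ[ℝ] ℝ) →ₗ[ℝ]
    EuclideanSpace ℝ (Fin k → Fin (Module.finrank ℝ V)) where
  toFun α := WithLp.toLp 2 fun f =>
    √((k.factorial : ℝ)⁻¹) * α (fun i => stdOrthonormalBasis ℝ V (f i))
  map_add' α β := by ext f; simp [mul_add]
  map_smul' c α := by ext f; simp; ring

theorem altNorm_eq_norm {k : ℕ} (α : V [⋀^Fin k]→ₗ[ℝ] ℝ) : altNorm α = ‖altCoord k α‖ := by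
  rw [EuclideanSpace.norm_eq, altNorm, altInner, Finset.mul_sum]
  congr 1
  refine Finset.sum_congr rfl fun f _ => ?_
  have h : (0 : ℝ) ≤ (k.factorial : ℝ)⁻¹ := by positivity
  simp only [altCoord, LinearMap.coe_mk, AddHom.coe_mk, Real.norm_eq_abs, sq_abs, mul_pow,
    Real.sq_sqrt h]
  ring

theorem altNorm_nonneg {k : ℕ} (α : V [⋀^Fin k]→ₗ[ℝ] ℝ) : 0 ≤ altNorm α := Real.sqrt_nonneg _

theorem altNorm_add_le {k : ℕ} (α β : V [⋀^Fin k]→ₗ[ℝ] ℝ) :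
    altNorm (α + β) ≤ altNorm α + altNorm β := by
  simp only [altNorm_eq_norm, map_add]; exact norm_add_le _ _

theorem altNorm_smul {k : ℕ} (c : ℝ) (α : V [⋀^Fin k]→ₗ[ℝ] ℝ) :
    altNorm (c • α) = |c| * altNorm α := by
  simp only [altNorm_eq_norm, map_smul, norm_smul, Real.norm_eq_abs]

theorem altNorm_eq_zero {k : ℕ} {α : V [⋀^Fin k]→ₗ[ℝ] ℝ} : altNorm α = 0 ↔ α = 0 := by
  refine ⟨fun h => ?_, fun h => by rw [h, altNorm_eq_norm, map_zero, norm_zero]⟩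
  rw [altNorm_eq_norm, norm_eq_zero] at h
  refine (stdOrthonormalBasis ℝ V).toBasis.ext_alternating fun f _ => ?_
  have h1 := congrArg (fun u : EuclideanSpace ℝ (Fin k → Fin (Module.finrank ℝ V)) => u f) h
  simpa [altCoord, k.factorial_ne_zero] using h1

/-- The inner product of forms in an arbitrary basis `X`, through the inverse Gram matrix:
`(1 / k!) g^{i₁j₁} ⋯ g^{i_kj_k} α_{i₁…i_k} β_{j₁…j_k}`. -/
theorem altInner_eq_gram {k n : ℕ} (X : Module.Basis (Fin n) ℝ V) (α β : V [⋀^Fin k]→ₗ[ℝ] ℝ) :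
    altInner α β = (k.factorial : ℝ)⁻¹ * ∑ g : Fin k → Fin n, ∑ h : Fin k → Fin n,
      (∏ m, (Matrix.of fun i j => inner ℝ (X i) (X j))⁻¹ (g m) (h m)) *
        (α (fun i => X (g i)) * β (fun i => X (h i))) := by
  set b := stdOrthonormalBasis ℝ V with hb
  set C : Matrix (Fin (Module.finrank ℝ V)) (Fin n) ℝ := Matrix.of fun j i => X.repr (b j) i with hC
  set A : Matrix (Fin (Module.finrank ℝ V)) (Fin n) ℝ := Matrix.of fun j i => inner ℝ (b j) (X i)
    with hA
  have hbX : ∀ j, b j = ∑ i, C j i • X i := fun j => (X.sum_repr (b j)).symm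
  have hXb : ∀ i, X i = ∑ j, A j i • b j := fun i => (b.sum_repr' (X i)).symm
  have h1 : A * C.transpose = 1 := by
    ext m j
    have : inner ℝ (b m) (b j) = ∑ i, C j i * A m i := by
      conv_lhs => rw [hbX j]
      simp [inner_sum, inner_smul_right, hA]
    rw [Matrix.mul_apply, Matrix.one_apply]
    simp only [Matrix.transpose_apply]
    rw [← orthonormal_iff_ite.1 b.orthonormal m j, this]
    exact Finset.sum_congr rfl fun i _ => mul_comm _ _
  have h2 : A.transpose * C = 1 := by
    ext i l
    have : X.repr (X i) l = ∑ j, A j i * C j l := by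
      conv_lhs => rw [hXb i]
      simp [hC]
    rw [Matrix.mul_apply, Matrix.one_apply]
    simp only [Matrix.transpose_apply]
    rw [← this, X.repr_self, Finsupp.single_apply]
  have h3 : (Matrix.of fun i j => inner ℝ (X i) (X j)) = A.transpose * A := by
    ext i j
    rw [Matrix.mul_apply, Matrix.of_apply, ← b.sum_inner_mul_inner (X i) (X j)]
    refine Finset.sum_congr rfl fun m _ => ?_
    simp [hA, real_inner_comm]
  have h4 : (Matrix.of fun i j => inner ℝ (X i) (X j))⁻¹ = C.transpose * C := by
    apply Matrix.inv_eq_right_inv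
    rw [h3, Matrix.mul_assoc, ← Matrix.mul_assoc A, h1, Matrix.one_mul, h2]
  have hexp : ∀ (γ : V [⋀^Fin k]→ₗ[ℝ] ℝ) (f : Fin k → Fin (Module.finrank ℝ V)),
      γ (fun i => b (f i)) = ∑ g : Fin k → Fin n, (∏ m, C (f m) (g m)) * γ (fun i => X (g i)) := by
    intro γ f
    have : (fun i => b (f i)) = fun i => ∑ j, C (f i) j • X j := by
      funext i; exact hbX (f i)
    rw [this]
    have h5 := γ.toMultilinearMap.map_sum (fun i j => C (f i) j • X j)
    have h6 := fun g : Fin k → Fin n =>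
      γ.toMultilinearMap.map_smul_univ (fun i => C (f i) (g i)) (fun i => X (g i))
    simp only [AlternatingMap.coe_multilinearMap] at h5 h6
    rw [h5]
    exact Finset.sum_congr rfl fun g _ => by rw [h6 g, smul_eq_mul]
  rw [altInner, h4]
  congr 1
  simp only [← hb, hexp α, hexp β, Finset.sum_mul_sum]
  rw [Finset.sum_comm]
  refine Finset.sum_congr rfl fun g _ => ?_
  rw [Finset.sum_comm]
  refine Finset.sum_congr rfl fun h _ => ?_
  have : ∏ m, (C.transpose * C) (g m) (h m)
      = ∑ f : Fin k → Fin (Module.finrank ℝ V), ∏ m, C (f m) (g m) * C (f m) (h m) := by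
    simp only [Matrix.mul_apply, Matrix.transpose_apply]
    rw [Finset.prod_univ_sum, Fintype.piFinset_univ]
  rw [this, Finset.sum_mul]
  refine Finset.sum_congr rfl fun f _ => ?_
  rw [Finset.prod_mul_distrib]
  ring

/-- Alternating forms on a finite-dimensional space are continuous. -/
def altToContinuous {W : Type*} [NormedAddCommGroup W] [NormedSpace ℝ W] [FiniteDimensional ℝ W]
    {k : ℕ} (α : W [⋀^Fin k]→ₗ[ℝ] ℝ) : W [⋀^Fin k]→L[ℝ] ℝ where
  toMultilinearMap := α.toMultilinearMap
  map_eq_zero_of_eq' := α.map_eq_zero_of_eq'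
  cont := by
    have h : (α : (Fin k → W) → ℝ) = fun v => ∑ g : Fin k → Fin (Module.finrank ℝ W),
        (∏ m, (Module.finBasis ℝ W).repr (v m) (g m)) *
          α (fun i => Module.finBasis ℝ W (g i)) := by
      funext v
      have hv : v = fun i => ∑ j, (Module.finBasis ℝ W).repr (v i) j • Module.finBasis ℝ W j := by
        funext i; exact ((Module.finBasis ℝ W).sum_repr (v i)).symm
      have h5 := α.toMultilinearMap.map_sum
        (fun i j => (Module.finBasis ℝ W).repr (v i) j • Module.finBasis ℝ W j)
      have h6 := fun g : Fin k → Fin (Module.finrank ℝ W) =>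
        α.toMultilinearMap.map_smul_univ (fun i => (Module.finBasis ℝ W).repr (v i) (g i))
          (fun i => Module.finBasis ℝ W (g i))
      simp only [AlternatingMap.coe_multilinearMap] at h5 h6
      conv_lhs => rw [hv]
      rw [h5]
      exact Finset.sum_congr rfl fun g _ => by rw [h6 g, smul_eq_mul]
    change Continuous (α : (Fin k → W) → ℝ)
    rw [h]
    refine continuous_finsetSum _ fun g _ => Continuous.mul ?_ continuous_const
    refine continuous_finsetProd _ fun m _ => ?_
    exact ((Module.finBasis ℝ W).coord (g m)).continuous_of_finiteDimensional.comp
      (continuous_apply m)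

end LinearAlgebra

/-! ### Differential forms on a Riemannian manifold -/

section Manifold

set_option linter.unusedSectionVars false

variable (n : ℕ) (M : Type*) [EMetricSpace M] [ChartedSpace (EuclideanSpace ℝ (Fin n)) M]
  [IsManifold (𝓡 n) ∞ M]

/-- A `k`-form on `M`, with no regularity: an alternating form on each tangent space. -/
abbrev DForm (k : ℕ) : Type _ := (x : M) → TangentSpace (𝓡 n) x [⋀^Fin k]→ₗ[ℝ] ℝ

/-- The map `ℝⁿ → T_xM` given, for `x` in the domain of the chart at `x₀`, by the differential at
the image of `x` of the inverse of this chart. -/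
def coordFrame {n : ℕ} {M : Type*} [EMetricSpace M] [ChartedSpace (EuclideanSpace ℝ (Fin n)) M]
    [IsManifold (𝓡 n) ∞ M] (x₀ x : M) : EuclideanSpace ℝ (Fin n) →L[ℝ] TangentSpace (𝓡 n) x :=
  (trivializationAt (EuclideanSpace ℝ (Fin n)) (TangentSpace (𝓡 n)) x₀).symmL ℝ x

variable {n M}

theorem coordFrame_eq_mfderiv {x₀ x : M} 
    (hx : x ∈ (chartAt (EuclideanSpace ℝ (Fin n)) x₀).source) :
    coordFrame x₀ x = mfderivWithin 𝓘(ℝ, EuclideanSpace ℝ (Fin n)) (𝓡 n) (extChartAt (𝓡 n) x₀).symm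
      (range (𝓡 n)) (extChartAt (𝓡 n) x₀ x) :=
  TangentBundle.symmL_trivializationAt hx

/-- The expression of a form in the chart at `x₀`: its pullback by the inverse of the chart. -/
def chartRep {k : ℕ} (x₀ : M) (a : DForm n M k) (y : EuclideanSpace ℝ (Fin n)) :
    EuclideanSpace ℝ (Fin n) [⋀^Fin k]→L[ℝ] ℝ :=
  altToContinuous ((a ((extChartAt (𝓡 n) x₀).symm y)).compLinearMap
    (coordFrame x₀ ((extChartAt (𝓡 n) x₀).symm y)).toLinearMap)

/-- Smooth forms with compact support. -/
structure IsTestForm {k : ℕ} (φ : DForm n M k) : Prop where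
  smooth : ∀ x₀ : M, ContDiffOn ℝ ∞ (chartRep x₀ φ) (extChartAt (𝓡 n) x₀).target
  compact_support : IsCompact (closure {x | φ x ≠ 0})

/-- The exterior derivative of a smooth form, computed at `x` in the chart at `x` and pulled back
to `T_xM` by the differential of that chart. -/
def dForm {k : ℕ} (φ : DForm n M k) : DForm n M (k + 1) := fun x =>
  (extDeriv (chartRep x φ) (extChartAt (𝓡 n) x x)).toAlternatingMap.compLinearMap
    ((trivializationAt (EuclideanSpace ℝ (Fin n)) (TangentSpace (𝓡 n)) x).continuousLinearMapAt
      ℝ x).toLinearMap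

variable (n M) in
/-- An orientation of `M`: an orientation of each tangent space, such that near each point the
orientations agree in a local trivialization of the tangent bundle. -/
structure ManifoldOrientation where
  at_point : (x : M) → Orientation ℝ (TangentSpace (𝓡 n) x) (Fin n)
  locally_constant : ∀ x₀ : M, ∃ U ∈ 𝓝 x₀, ∃ hU : U ⊆
      (trivializationAt (EuclideanSpace ℝ (Fin n)) (TangentSpace (𝓡 n)) x₀).baseSet,
    ∃ o₀ : Orientation ℝ (EuclideanSpace ℝ (Fin n)) (Fin n), ∀ (x : M) (hx : x ∈ U),
      Orientation.map (Fin n)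
        ((trivializationAt (EuclideanSpace ℝ (Fin n)) (TangentSpace (𝓡 n))
          x₀).continuousLinearEquivAt ℝ x (hU hx)).toLinearEquiv (at_point x) = o₀

variable [RiemannianBundle (fun x : M => TangentSpace (𝓡 n) x)]

instance tangentSpace_finiteDimensional (x : M) : FiniteDimensional ℝ (TangentSpace (𝓡 n) x) :=
  inferInstanceAs (FiniteDimensional ℝ (EuclideanSpace ℝ (Fin n)))

instance tangentSpace_finrank (x : M) : Fact (Module.finrank ℝ (TangentSpace (𝓡 n) x) = n) :=
  ⟨(finrank_euclideanSpace_fin : Module.finrank ℝ (EuclideanSpace ℝ (Fin n)) = n)⟩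

/-- The Riemannian volume form of the orientation. -/
def volForm (o : ManifoldOrientation n M) (x : M) : TangentSpace (𝓡 n) x [⋀^Fin n]→ₗ[ℝ] ℝ :=
  (o.at_point x).volumeForm

/-- The matrix `g_{ij}` of the Riemannian metric at `x` in the chart at `x₀`. -/
def gramMatrix (x₀ x : M) : Matrix (Fin n) (Fin n) ℝ := Matrix.of fun i j =>
  inner ℝ (coordFrame x₀ x (EuclideanSpace.basisFun (Fin n) ℝ i))
    (coordFrame x₀ x (EuclideanSpace.basisFun (Fin n) ℝ j))

variable [MeasurableSpace M] [BorelSpace M]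

variable (n M) in
/-- The Riemannian volume measure: the measure which in each chart domain is given by
`√det g dy₁ ⋯ dy_n`, defined as the supremum of these measures over all charts
(which agree on overlaps). -/
def riemVol : Measure M := ⨆ x₀ : M,
  ((volume.restrict (extChartAt (𝓡 n) x₀).target).withDensity fun y => ENNReal.ofReal
    √(gramMatrix (n := n) x₀ ((extChartAt (𝓡 n) x₀).symm y)).det).map (extChartAt (𝓡 n) x₀).symm

/-- Measurable forms: those with measurable components in each chart. -/
def MeasurableForm {k : ℕ} (a : DForm n M k) : Prop :=
  ∀ (x₀ : M) (v : Fin k → EuclideanSpace ℝ (Fin n)), Measurable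
    fun x : (chartAt (EuclideanSpace ℝ (Fin n)) x₀).source =>
      a x.1 (fun i => coordFrame x₀ x.1 (v i))

theorem MeasurableForm.add {k : ℕ} {a b : DForm n M k} (ha : MeasurableForm a)
    (hb : MeasurableForm b) : MeasurableForm (a + b) :=
  fun x₀ v => (ha x₀ v).add (hb x₀ v)

theorem MeasurableForm.smul {k : ℕ} {a : DForm n M k} (c : ℝ) (ha : MeasurableForm a) :
    MeasurableForm (c • a) :=
  fun x₀ v => (ha x₀ v).const_mul c

theorem measurableForm_zero {k : ℕ} : MeasurableForm (0 : DForm n M k) :=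
  fun _ _ => measurable_const

variable [IsContMDiffRiemannianBundle (𝓡 n) ∞ (EuclideanSpace ℝ (Fin n))
  (fun x : M => TangentSpace (𝓡 n) x)]

theorem continuousOn_gramMatrix (x₀ : M) (i j : Fin n) :
    ContinuousOn (fun x => gramMatrix x₀ x i j)
      (chartAt (EuclideanSpace ℝ (Fin n)) x₀).source := by
  let e := trivializationAt (EuclideanSpace ℝ (Fin n)) (TangentSpace (𝓡 n) (M := M)) x₀
  let b := (EuclideanSpace.basisFun (Fin n) ℝ).toBasis
  have h1 := fun i => (e.contMDiffOn_localFrame_baseSet (I := 𝓡 n) 0 b i)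
  have h0 : IsContMDiffRiemannianBundle (𝓡 n) 0 (EuclideanSpace ℝ (Fin n))
      (fun x : M => TangentSpace (𝓡 n) x) :=
    IsContMDiffRiemannianBundle.of_le (n := ∞) (by simp)
  have h2 := (ContMDiffOn.inner_bundle (E := fun x : M => TangentSpace (𝓡 n) x)
    (h := h0) (h1 i) (h1 j)).continuousOn
  have hs : e.baseSet = (chartAt (EuclideanSpace ℝ (Fin n)) x₀).source := by simp [e]
  rw [← hs]
  refine h2.congr fun x hx => ?_
  have h3 : ∀ i, e.localFrame b i x = coordFrame x₀ x (EuclideanSpace.basisFun (Fin n) ℝ i) := by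
    intro i
    rw [e.localFrame_apply_of_mem_baseSet b hx, coordFrame, Trivialization.symmL_apply _ hx]
    simp [Bundle.Trivialization.basisAt, e, b]
  simp only [h3, gramMatrix, Matrix.of_apply]

/-- The coordinate basis of the tangent space at a point of a chart domain. -/
theorem exists_coordBasis (x₀ x : M) (hx : x ∈ (chartAt (EuclideanSpace ℝ (Fin n)) x₀).source) :
    ∃ X : Module.Basis (Fin n) ℝ (TangentSpace (𝓡 n) x),
      ∀ i, X i = coordFrame x₀ x (EuclideanSpace.basisFun (Fin n) ℝ i) := by
  let e := trivializationAt (EuclideanSpace ℝ (Fin n)) (TangentSpace (𝓡 n) (M := M)) x₀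
  let b := (EuclideanSpace.basisFun (Fin n) ℝ).toBasis
  have hs : x ∈ e.baseSet := by simpa [e] using hx
  refine ⟨e.basisAt b hs, fun i => ?_⟩
  rw [coordFrame, Trivialization.symmL_apply _ hs]
  simp [Bundle.Trivialization.basisAt, e, b]

theorem measurable_altInner [SecondCountableTopology M] {k : ℕ} {a b : DForm n M k}
    (ha : MeasurableForm a) (hb : MeasurableForm b) :
    Measurable fun x => altInner (a x) (b x) := by
  obtain ⟨s, hs, hcover⟩ := TopologicalSpace.countable_cover_nhds
    (f := fun x : M => (chartAt (EuclideanSpace ℝ (Fin n)) x).source)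
    fun x => chart_source_mem_nhds _ x
  have hloc : ∀ x₀ : M, Measurable fun x : (chartAt (EuclideanSpace ℝ (Fin n)) x₀).source =>
      altInner (a x.1) (b x.1) := by
    intro x₀
    have hG : Continuous fun x : (chartAt (EuclideanSpace ℝ (Fin n)) x₀).source =>
        gramMatrix (n := n) x₀ x.1 :=
      continuous_matrix fun i j =>
        continuousOn_iff_continuous_domRestrict.1 (continuousOn_gramMatrix x₀ i j)
    have hGinv : ∀ i j, Measurable fun x : (chartAt (EuclideanSpace ℝ (Fin n)) x₀).source =>
        (gramMatrix (n := n) x₀ x.1)⁻¹ i j := by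
      intro i j
      simp only [Matrix.inv_def, Ring.inverse_eq_inv', Matrix.smul_apply, smul_eq_mul]
      exact hG.matrix_det.measurable.inv.mul (hG.matrix_adjugate.matrix_elem i j).measurable
    have h : (fun x : (chartAt (EuclideanSpace ℝ (Fin n)) x₀).source =>
        altInner (a x.1) (b x.1)) = fun x => (k.factorial : ℝ)⁻¹ *
          ∑ g : Fin k → Fin n, ∑ h : Fin k → Fin n, (∏ m, (gramMatrix (n := n) x₀ x.1)⁻¹ (g m) (h m)) *
            (a x.1 (fun i => coordFrame x₀ x.1 (EuclideanSpace.basisFun (Fin n) ℝ (g i))) *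
              b x.1 (fun i => coordFrame x₀ x.1 (EuclideanSpace.basisFun (Fin n) ℝ (h i)))) := by
      funext x
      obtain ⟨X, hX⟩ := exists_coordBasis x₀ x.1 x.2
      rw [altInner_eq_gram X]
      simp only [hX]
      rfl
    rw [h]
    refine Measurable.const_mul ?_ _
    refine Finset.measurable_fun_sum _ fun g _ => Finset.measurable_fun_sum _ fun h _ => ?_
    exact (Finset.measurable_fun_prod _ fun m _ => hGinv _ _).mul ((ha x₀ _).mul (hb x₀ _))
  intro t ht
  have hpre : (fun x => altInner (a x) (b x)) ⁻¹' t = ⋃ x₀ ∈ s, Subtype.val ''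
      ((fun x : (chartAt (EuclideanSpace ℝ (Fin n)) x₀).source =>
        altInner (a x.1) (b x.1)) ⁻¹' t) := by
    ext x
    simp only [mem_preimage, mem_iUnion, mem_image, Subtype.exists, exists_and_right, exists_eq_right]
    constructor
    · intro hx
      have : x ∈ ⋃ x ∈ s, (chartAt (EuclideanSpace ℝ (Fin n)) x).source := hcover ▸ mem_univ x
      simp only [mem_iUnion] at this
      obtain ⟨x₀, h1, h2⟩ := this
      exact ⟨x₀, h1, h2, hx⟩
    · rintro ⟨x₀, h1, h2, hx⟩
      exact hx
  rw [hpre]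
  exact MeasurableSet.biUnion hs fun x₀ _ =>
    (chartAt (EuclideanSpace ℝ (Fin n)) x₀).open_source.measurableSet.subtype_image (hloc x₀ ht)

theorem measurable_altNorm [SecondCountableTopology M] {k : ℕ} {a : DForm n M k}
    (ha : MeasurableForm a) : Measurable fun x => altNorm (a x) :=
  (measurable_altInner ha ha).sqrt

/-! ### Forms up to almost everywhere equality and `L_p` forms -/

variable (n M) in
/-- The forms which vanish almost everywhere. -/
def aeZeroForms (k : ℕ) : Submodule ℝ (DForm n M k) where
  carrier := {a | ∀ᵐ x ∂riemVol n M, a x = 0}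
  zero_mem' := by
    change ∀ᵐ x ∂riemVol n M, (0 : DForm n M k) x = 0
    exact Eventually.of_forall fun _ => rfl
  add_mem' := by
    intro a b ha hb
    change ∀ᵐ x ∂riemVol n M, a x = 0 at ha
    change ∀ᵐ x ∂riemVol n M, b x = 0 at hb
    change ∀ᵐ x ∂riemVol n M, (a + b) x = 0
    filter_upwards [ha, hb] with x h1 h2
    rw [Pi.add_apply, h1, h2, add_zero]
  smul_mem' := by
    intro c a ha
    change ∀ᵐ x ∂riemVol n M, a x = 0 at ha
    change ∀ᵐ x ∂riemVol n M, (c • a) x = 0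
    filter_upwards [ha] with x h1
    rw [Pi.smul_apply, h1, smul_zero]

variable (n M) in
/-- Classes of forms modulo almost everywhere equality. -/
abbrev AEForm (k : ℕ) : Type _ := DForm n M k ⧸ aeZeroForms n M k

/-- The class of a form. -/
abbrev AEForm.mk {k : ℕ} (a : DForm n M k) : AEForm n M k := (aeZeroForms n M k).mkQ a

theorem ae_eq_of_rel {k : ℕ} {a b : DForm n M k} (h : (aeZeroForms n M k).quotientRel a b) :
    ∀ᵐ x ∂riemVol n M, a x = b x := by
  have h1 : a - b ∈ aeZeroForms n M k := (Submodule.quotientRel_def _).1 h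
  have h2 : ∀ᵐ x ∂riemVol n M, (a - b) x = 0 := h1
  filter_upwards [h2] with x hx
  exact sub_eq_zero.1 hx

theorem rel_of_ae_eq {k : ℕ} {a b : DForm n M k} (h : ∀ᵐ x ∂riemVol n M, a x = b x) :
    (aeZeroForms n M k).quotientRel a b := by
  refine (Submodule.quotientRel_def _).2 ?_
  change ∀ᵐ x ∂riemVol n M, (a - b) x = 0
  filter_upwards [h] with x hx
  exact sub_eq_zero.2 hx

/-- The norm `(∫ |a|^p)^{1/p}`, with value `∞` allowed. -/
def lpENorm {k : ℕ} (p : ℝ) (a : AEForm n M k) : ℝ≥0∞ :=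
  Quotient.liftOn' a
    (fun a => (∫⁻ x, ENNReal.ofReal (altNorm (a x)) ^ p ∂riemVol n M) ^ (1 / p))
    fun a b h => by
      have h1 : ∫⁻ x, ENNReal.ofReal (altNorm (a x)) ^ p ∂riemVol n M
          = ∫⁻ x, ENNReal.ofReal (altNorm (b x)) ^ p ∂riemVol n M := by
        refine lintegral_congr_ae ?_
        filter_upwards [ae_eq_of_rel h] with x hx
        rw [hx]
      simp only [h1]

theorem lpENorm_mk {k : ℕ} (p : ℝ) (a : DForm n M k) : lpENorm p (AEForm.mk a)
    = (∫⁻ x, ENNReal.ofReal (altNorm (a x)) ^ p ∂riemVol n M) ^ (1 / p) := rfl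

/-- `L_p` forms: classes of measurable forms with finite `L_p` norm. -/
def IsLpForm {k : ℕ} (p : ℝ) (a : AEForm n M k) : Prop :=
  (∃ w : DForm n M k, MeasurableForm w ∧ AEForm.mk w = a) ∧ lpENorm p a < ⊤

/-- The nonlinear map `h ↦ |h|^{p-2} h`. -/
def powForm {k : ℕ} (p : ℝ) (a : AEForm n M k) : AEForm n M k :=
  Quotient.map' (fun (a : DForm n M k) x => altNorm (a x) ^ (p - 2) • a x)
    (fun a b h => rel_of_ae_eq (by
      filter_upwards [ae_eq_of_rel h] with x hx
      rw [hx])) a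

/-- The Hodge star `⋆ : Λ^k → Λ^l`, `k + l = n`, on classes of forms. -/
def hodgeStar (o : ManifoldOrientation n M) {k l : ℕ} (h : k + l = n) :
    AEForm n M k →ₗ[ℝ] AEForm n M l :=
  (aeZeroForms n M k).mapQ (aeZeroForms n M l)
    (LinearMap.pi fun x => (altStar h (volForm o x)).comp (LinearMap.proj x))
    (fun a ha => by
      have ha' : ∀ᵐ x ∂riemVol n M, a x = 0 := ha
      change ∀ᵐ x ∂riemVol n M, altStar h (volForm o x) (a x) = 0
      filter_upwards [ha'] with x hx
      rw [hx, map_zero])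

/-- The nonlinear star `⋆_p h = ⋆ |h|^{p-2} h`. -/
def hodgeStarPow (o : ManifoldOrientation n M) {k l : ℕ} (h : k + l = n) (p : ℝ)
    (a : AEForm n M k) : AEForm n M l := hodgeStar o h (powForm p a)

/-! ### Weak exterior derivative and codifferential -/

/-- The function `c` such that `a ∧ b = c · vol`, for forms of complementary degrees. -/
def wedgeDensity (o : ManifoldOrientation n M) {k m : ℕ} (h : k + m = n) (a : DForm n M k)
    (b : DForm n M m) (x : M) : ℝ :=
  altInner ((altWedge (a x) (b x)).domDomCongr (finCongr h)) (volForm o x)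

/-- `g` is the weak exterior derivative of `f`: `∫ f ∧ dψ = (-1)^{k+1} ∫ g ∧ ψ` for all smooth
compactly supported forms `ψ` of degree `n - k - 1`. -/
def HasWeakD (o : ManifoldOrientation n M) {k : ℕ} (f : DForm n M k) (g : DForm n M (k + 1)) :
    Prop :=
  ∀ (m : ℕ) (h : k + 1 + m = n) (ψ : DForm n M m), IsTestForm ψ →
    Integrable (wedgeDensity o (k := k) (m := m + 1) (by omega) f (dForm ψ)) (riemVol n M) ∧
    Integrable (wedgeDensity o h g ψ) (riemVol n M) ∧
    ∫ x, wedgeDensity o (k := k) (m := m + 1) (by omega) f (dForm ψ) x ∂riemVol n M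
      = (-1) ^ (k + 1) * ∫ x, wedgeDensity o h g ψ x ∂riemVol n M

/-- `g = d^* f` weakly: `∫ ⟨f, dφ⟩ = ∫ ⟨g, φ⟩` for all smooth compactly supported `k`-forms `φ`. -/
def HasWeakCod {k : ℕ} (f : DForm n M (k + 1)) (g : DForm n M k) : Prop :=
  ∀ φ : DForm n M k, IsTestForm φ →
    Integrable (fun x => altInner (f x) (dForm φ x)) (riemVol n M) ∧
    Integrable (fun x => altInner (g x) (φ x)) (riemVol n M) ∧
    ∫ x, altInner (f x) (dForm φ x) ∂riemVol n M = ∫ x, altInner (g x) (φ x) ∂riemVol n M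

/-- `df = g` weakly, for classes of forms. -/
def WeakD (o : ManifoldOrientation n M) {k : ℕ} (f : AEForm n M k) (g : AEForm n M (k + 1)) :
    Prop :=
  ∃ (f' : DForm n M k) (g' : DForm n M (k + 1)),
    AEForm.mk f' = f ∧ AEForm.mk g' = g ∧ HasWeakD o f' g'

/-- `d^* f = g` weakly, for classes of forms. -/
def WeakCod {k : ℕ} (f : AEForm n M (k + 1)) (g : AEForm n M k) : Prop :=
  ∃ (f' : DForm n M (k + 1)) (g' : DForm n M k),
    AEForm.mk f' = f ∧ AEForm.mk g' = g ∧ HasWeakCod f' g'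

/-- `df = 0` weakly. -/
def IsClosedForm (o : ManifoldOrientation n M) {k : ℕ} (f : AEForm n M k) : Prop := WeakD o f 0

/-- `d^* f = 0` weakly; no condition in degree zero. -/
def IsCoclosedForm : {k : ℕ} → AEForm n M k → Prop
  | 0, _ => True
  | _ + 1, f => WeakCod f 0

theorem wedgeDensity_add (o : ManifoldOrientation n M) {k m : ℕ} (h : k + m = n)
    (a a' : DForm n M k) (b : DForm n M m) :
    wedgeDensity o h (a + a') b = wedgeDensity o h a b + wedgeDensity o h a' b := by
  funext x
  simp only [wedgeDensity, Pi.add_apply, altWedge_add_left, AlternatingMap.domDomCongr_add,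
    altInner_add_left]

theorem wedgeDensity_smul (o : ManifoldOrientation n M) {k m : ℕ} (h : k + m = n) (c : ℝ)
    (a : DForm n M k) (b : DForm n M m) :
    wedgeDensity o h (c • a) b = c • wedgeDensity o h a b := by
  funext x
  simp only [wedgeDensity, Pi.smul_apply, altWedge_smul_left, AlternatingMap.domDomCongr_smul,
    altInner_smul_left, smul_eq_mul]

theorem WeakD.add {o : ManifoldOrientation n M} {k : ℕ} {f₁ f₂ : AEForm n M k}
    {g₁ g₂ : AEForm n M (k + 1)} (h₁ : WeakD o f₁ g₁) (h₂ : WeakD o f₂ g₂) :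
    WeakD o (f₁ + f₂) (g₁ + g₂) := by
  obtain ⟨a₁, b₁, rfl, rfl, H₁⟩ := h₁
  obtain ⟨a₂, b₂, rfl, rfl, H₂⟩ := h₂
  refine ⟨a₁ + a₂, b₁ + b₂, map_add _ _ _, map_add _ _ _, fun m h ψ hψ => ?_⟩
  obtain ⟨i1, i2, i3⟩ := H₁ m h ψ hψ
  obtain ⟨j1, j2, j3⟩ := H₂ m h ψ hψ
  simp only [wedgeDensity_add]
  refine ⟨i1.add j1, i2.add j2, ?_⟩
  rw [integral_add' i1 j1, integral_add' i2 j2, i3, j3, mul_add]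

theorem WeakD.smul {o : ManifoldOrientation n M} {k : ℕ} {f : AEForm n M k}
    {g : AEForm n M (k + 1)} (c : ℝ) (h : WeakD o f g) : WeakD o (c • f) (c • g) := by
  obtain ⟨a, b, rfl, rfl, H⟩ := h
  refine ⟨c • a, c • b, map_smul _ _ _, map_smul _ _ _, fun m h ψ hψ => ?_⟩
  obtain ⟨i1, i2, i3⟩ := H m h ψ hψ
  simp only [wedgeDensity_smul]
  refine ⟨i1.smul c, i2.smul c, ?_⟩
  simp only [Pi.smul_apply, smul_eq_mul, integral_const_mul, i3]
  ring

theorem WeakCod.add {k : ℕ} {f₁ f₂ : AEForm n M (k + 1)} {g₁ g₂ : AEForm n M k}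
    (h₁ : WeakCod f₁ g₁) (h₂ : WeakCod f₂ g₂) : WeakCod (f₁ + f₂) (g₁ + g₂) := by
  obtain ⟨a₁, b₁, rfl, rfl, H₁⟩ := h₁
  obtain ⟨a₂, b₂, rfl, rfl, H₂⟩ := h₂
  refine ⟨a₁ + a₂, b₁ + b₂, map_add _ _ _, map_add _ _ _, fun φ hφ => ?_⟩
  obtain ⟨i1, i2, i3⟩ := H₁ φ hφ
  obtain ⟨j1, j2, j3⟩ := H₂ φ hφ
  simp only [Pi.add_apply, altInner_add_left]
  refine ⟨i1.add j1, i2.add j2, ?_⟩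
  rw [integral_add i1 j1, integral_add i2 j2, i3, j3]

theorem WeakCod.smul {k : ℕ} {f : AEForm n M (k + 1)} {g : AEForm n M k} (c : ℝ)
    (h : WeakCod f g) : WeakCod (c • f) (c • g) := by
  obtain ⟨a, b, rfl, rfl, H⟩ := h
  refine ⟨c • a, c • b, map_smul _ _ _, map_smul _ _ _, fun φ hφ => ?_⟩
  obtain ⟨i1, i2, i3⟩ := H φ hφ
  simp only [Pi.smul_apply, altInner_smul_left]
  refine ⟨i1.const_mul c, i2.const_mul c, ?_⟩
  rw [integral_const_mul, integral_const_mul, i3]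

theorem weakD_zero (o : ManifoldOrientation n M) {k : ℕ} :
    WeakD o (0 : AEForm n M k) (0 : AEForm n M (k + 1)) := by
  have h0 : ∀ {k m : ℕ} (h : k + m = n) (b : DForm n M m),
      wedgeDensity o h (0 : DForm n M k) b = 0 := by
    intro k m h b
    have := wedgeDensity_smul o h 0 (0 : DForm n M k) b
    simpa using this
  refine ⟨0, 0, map_zero _, map_zero _, fun m h ψ hψ => ?_⟩
  simp only [h0]
  exact ⟨integrable_zero _ _ _, integrable_zero _ _ _, by simp⟩

theorem weakCod_zero {k : ℕ} : WeakCod (0 : AEForm n M (k + 1)) (0 : AEForm n M k) := by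
  have h0 : ∀ {k : ℕ} (x : M) (b : TangentSpace (𝓡 n) x [⋀^Fin k]→ₗ[ℝ] ℝ),
      altInner ((0 : DForm n M k) x) b = 0 := by
    intro k x b
    simp [altInner]
  refine ⟨0, 0, map_zero _, map_zero _, fun φ hφ => ?_⟩
  simp only [h0]
  exact ⟨integrable_zero _ _ _, integrable_zero _ _ _, by simp⟩

/-! ### Harmonic and coharmonic forms -/

/-- The space `𝓗_p^k(M)` of `p`-harmonic forms: `h ∈ L_p`, `dh = 0` and `d^*(|h|^{p-2} h) = 0`. -/
def pHarmonic (o : ManifoldOrientation n M) (p : ℝ) (k : ℕ) : Set (AEForm n M k) :=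
  {h | IsLpForm p h ∧ IsClosedForm o h ∧ IsCoclosedForm (powForm p h)}

/-- The space `𝓔_p^k(M)` of `p`-coharmonic forms: `f ∈ L_p`, `d^*f = 0` and
`d(|f|^{p-2} f) = 0`. -/
def pCoharmonic (o : ManifoldOrientation n M) (p : ℝ) (k : ℕ) : Set (AEForm n M k) :=
  {f | IsLpForm p f ∧ IsCoclosedForm f ∧ IsClosedForm o (powForm p f)}

/-! ### The Banach space `L_p^k(M)`, torsion cohomology and torsion homology -/

variable [SecondCountableTopology M]

theorem lpENorm_add_le {k : ℕ} {p : ℝ} (hp : 1 ≤ p) {a b : AEForm n M k} (ha : IsLpForm p a)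
    (hb : IsLpForm p b) : lpENorm p (a + b) ≤ lpENorm p a + lpENorm p b := by
  obtain ⟨⟨a, ma, rfl⟩, -⟩ := ha
  obtain ⟨⟨b, mb, rfl⟩, -⟩ := hb
  have hp0 : 0 ≤ p := by linarith
  rw [← map_add, lpENorm_mk, lpENorm_mk, lpENorm_mk]
  refine le_trans ?_ (ENNReal.lintegral_Lp_add_le (measurable_altNorm ma).ennreal_ofReal.aemeasurable
    (measurable_altNorm mb).ennreal_ofReal.aemeasurable hp)
  refine ENNReal.rpow_le_rpow (lintegral_mono fun x => ENNReal.rpow_le_rpow ?_ hp0) (by positivity)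
  rw [Pi.add_apply, Pi.add_apply, ← ENNReal.ofReal_add (altNorm_nonneg _) (altNorm_nonneg _)]
  exact ENNReal.ofReal_le_ofReal (altNorm_add_le _ _)

theorem lpENorm_smul {k : ℕ} {p : ℝ} (hp : 1 ≤ p) (c : ℝ) (a : AEForm n M k) :
    lpENorm p (c • a) = ENNReal.ofReal |c| * lpENorm p a := by
  obtain ⟨a, rfl⟩ := Submodule.mkQ_surjective _ a
  have hp0 : 0 < p := by linarith
  change lpENorm p (c • AEForm.mk a) = _ * lpENorm p (AEForm.mk a)
  rw [← map_smul, lpENorm_mk, lpENorm_mk]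
  have : ∀ x, ENNReal.ofReal (altNorm ((c • a) x)) ^ p
      = ENNReal.ofReal |c| ^ p * ENNReal.ofReal (altNorm (a x)) ^ p := by
    intro x
    rw [Pi.smul_apply, altNorm_smul, ENNReal.ofReal_mul (abs_nonneg c),
      ENNReal.mul_rpow_of_nonneg _ _ hp0.le]
  simp only [this]
  rw [lintegral_const_mul' _ _ (ENNReal.rpow_ne_top_of_nonneg hp0.le ENNReal.ofReal_ne_top),
    ENNReal.mul_rpow_of_nonneg _ _ (by positivity), ← ENNReal.rpow_mul,
    mul_one_div_cancel hp0.ne', ENNReal.rpow_one]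

theorem lpENorm_zero {k : ℕ} {p : ℝ} (hp : 1 ≤ p) : lpENorm p (0 : AEForm n M k) = 0 := by
  have := lpENorm_smul hp 0 (0 : AEForm n M k)
  simpa using this

theorem eq_zero_of_lpENorm {k : ℕ} {p : ℝ} (hp : 1 ≤ p) {a : AEForm n M k} (ha : IsLpForm p a)
    (h : lpENorm p a = 0) : a = 0 := by
  obtain ⟨⟨a, ma, rfl⟩, -⟩ := ha
  have hp0 : 0 < p := by linarith
  rw [lpENorm_mk, ENNReal.rpow_eq_zero_iff_of_pos (by positivity),
    lintegral_eq_zero_iff ((measurable_altNorm ma).ennreal_ofReal.pow_const p)] at h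
  refine (Submodule.Quotient.mk_eq_zero _).2 ?_
  change ∀ᵐ x ∂riemVol n M, a x = 0
  filter_upwards [h] with x hx
  have h1 : ENNReal.ofReal (altNorm (a x)) = 0 :=
    (ENNReal.rpow_eq_zero_iff_of_pos hp0).1 hx
  exact altNorm_eq_zero.1 (le_antisymm (ENNReal.ofReal_eq_zero.1 h1) (altNorm_nonneg _))

variable (n M) in
/-- The space `L_p^k(M)`. -/
def LpForms (p : ℝ) [hp : Fact (1 ≤ p)] (k : ℕ) : Submodule ℝ (AEForm n M k) where
  carrier := {a | IsLpForm p a}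
  zero_mem' := ⟨⟨0, measurableForm_zero, map_zero _⟩, by simp [lpENorm_zero hp.out]⟩
  add_mem' := by
    intro a b ha hb
    refine ⟨?_, (lpENorm_add_le hp.out ha hb).trans_lt (ENNReal.add_lt_top.2 ⟨ha.2, hb.2⟩)⟩
    obtain ⟨⟨a, ma, rfl⟩, -⟩ := ha
    obtain ⟨⟨b, mb, rfl⟩, -⟩ := hb
    exact ⟨a + b, ma.add mb, map_add _ _ _⟩
  smul_mem' := by
    intro c a ha
    refine ⟨?_, ?_⟩
    · obtain ⟨⟨a, ma, rfl⟩, -⟩ := ha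
      exact ⟨c • a, ma.smul c, map_smul _ _ _⟩
    · rw [lpENorm_smul hp.out]
      exact ENNReal.mul_lt_top ENNReal.ofReal_lt_top ha.2

instance LpForms.norm (p : ℝ) [Fact (1 ≤ p)] (k : ℕ) : Norm (LpForms n M p k) :=
  ⟨fun a => (lpENorm p (a : AEForm n M k)).toReal⟩

theorem LpForms.core (p : ℝ) [hp : Fact (1 ≤ p)] (k : ℕ) :
    NormedSpace.Core ℝ (LpForms n M p k) where
  norm_nonneg _ := ENNReal.toReal_nonneg
  norm_smul c a := by
    change (lpENorm p (c • (a : AEForm n M k))).toReal = _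
    rw [lpENorm_smul hp.out, ENNReal.toReal_mul, ENNReal.toReal_ofReal (abs_nonneg c)]
    rfl
  norm_triangle a b := by
    change (lpENorm p ((a : AEForm n M k) + (b : AEForm n M k))).toReal ≤
      (lpENorm p (a : AEForm n M k)).toReal + (lpENorm p (b : AEForm n M k)).toReal
    rw [← ENNReal.toReal_add a.2.2.ne b.2.2.ne]
    exact ENNReal.toReal_mono (ENNReal.add_lt_top.2 ⟨a.2.2, b.2.2⟩).ne
      (lpENorm_add_le hp.out a.2 b.2)
  norm_eq_zero_iff a := by
    change (lpENorm p (a : AEForm n M k)).toReal = 0 ↔ _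
    rw [ENNReal.toReal_eq_zero_iff, or_iff_left a.2.2.ne]
    refine ⟨fun h => Subtype.ext (eq_zero_of_lpENorm hp.out a.2 h), fun h => ?_⟩
    rw [h]
    exact lpENorm_zero hp.out

instance LpForms.normedAddCommGroup (p : ℝ) [Fact (1 ≤ p)] (k : ℕ) :
    NormedAddCommGroup (LpForms n M p k) := NormedAddCommGroup.ofCore (LpForms.core p k)

instance LpForms.normedSpace (p : ℝ) [Fact (1 ≤ p)] (k : ℕ) :
    NormedSpace ℝ (LpForms n M p k) := NormedSpace.ofCore (LpForms.core p k)

/-- `B_p^k(M)`: the `L_p` forms `dβ` with `β` an `L_p` form of degree `k - 1`. -/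
def exactForms (o : ManifoldOrientation n M) (p : ℝ) [Fact (1 ≤ p)] :
    (k : ℕ) → Submodule ℝ (LpForms n M p k)
  | 0 => ⊥
  | k + 1 =>
    { carrier := {ζ | ∃ β : LpForms n M p k, WeakD o (β : AEForm n M k) (ζ : AEForm n M (k + 1))}
      zero_mem' := ⟨0, weakD_zero o⟩
      add_mem' := by
        rintro _ _ ⟨β, hβ⟩ ⟨γ, hγ⟩
        exact ⟨β + γ, hβ.add hγ⟩
      smul_mem' := by
        rintro c _ ⟨β, hβ⟩
        exact ⟨c • β, hβ.smul c⟩ }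

variable (n M) in
/-- `D_p^k(M)`: the `L_p` forms `d^*β` with `β` an `L_p` form of degree `k + 1`. In degrees `k ≥ n`
this is the zero space, as there are no nonzero `(k + 1)`-forms. -/
def coexactForms (p : ℝ) [Fact (1 ≤ p)] (k : ℕ) : Submodule ℝ (LpForms n M p k) where
  carrier := {ζ | (n ≤ k → ζ = 0) ∧ ∃ β : LpForms n M p (k + 1),
    WeakCod (β : AEForm n M (k + 1)) (ζ : AEForm n M k)}
  zero_mem' := ⟨fun _ => rfl, 0, weakCod_zero⟩
  add_mem' := by
    rintro a b ⟨h₁, β, hβ⟩ ⟨h₂, γ, hγ⟩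
    exact ⟨fun h => by rw [h₁ h, h₂ h, add_zero], β + γ, hβ.add hγ⟩
  smul_mem' := by
    rintro c a ⟨h₁, β, hβ⟩
    exact ⟨fun h => by rw [h₁ h, smul_zero], c • β, hβ.smul c⟩

/-- The torsion cohomology `T_p^k(M)`: the `L_p` closure of `B_p^k(M)` modulo `B_p^k(M)`. -/
abbrev TorsionCohomology (o : ManifoldOrientation n M) (p : ℝ) [Fact (1 ≤ p)] (k : ℕ) : Type _ :=
  (exactForms o p k).topologicalClosure ⧸
    (exactForms o p k).submoduleOf (exactForms o p k).topologicalClosure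

variable (n M) in
/-- The torsion homology `𝓣_p^k(M)`: the `L_p` closure of `D_p^k(M)` modulo `D_p^k(M)`. -/
abbrev TorsionHomology (p : ℝ) [Fact (1 ≤ p)] (k : ℕ) : Type _ :=
  (coexactForms n M p k).topologicalClosure ⧸
    (coexactForms n M p k).submoduleOf (coexactForms n M p k).topologicalClosure

end Manifold

end

noncomputable section

/-! ### The Hodge star on a Euclidean vector space -/

section HodgeStar

/-! Everything rests on two pointwise facts about the star and one about the power map.

On a Euclidean space `⋆⋆ = ε` with a sign `ε = ±1`, and `⋆` is its own adjoint up to the same sign;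
hence `⋆` preserves the norm of forms (`altStar_altStar`, `altInner_altStar`, `altNorm_altStar`).
Moreover `α ∧ β = ⟨⋆α, β⟩ τ` (`altInner_altWedge`). The weak `d` is defined by the wedge pairing and
the weak `d^*` by the inner product, both against the same test forms, so this identity turns `df =
g` directly into `d^*(⋆f) = (-1)^{k+1} ⋆g` (`weakD_iff_weakCod`). No integration by parts occurs.

The map `h ↦ |h|^{p-2} h` raises norms to the power `p - 1`, so `(p - 1)p' = p` gives the norm
identity, and its inverse is the same map with exponent `p'` (`powForm_powForm`, `lpENorm_powForm`).
It commutes with `⋆` because `⋆` is linear and norm preserving on each tangent space.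

Harmonicity and coharmonicity each ask for closedness of one of `h`, `|h|^{p-2} h` and coclosedness
of the other. The power map exchanges the two forms, and `⋆` exchanges the two conditions; this
gives the two bijections. For the torsion spaces, `⋆` is an isometry of `L_p` carrying `B_p` onto
`D_p`; such a map respects closures and quotient seminorms. -/

theorem exists_perm_of_disjoint_range {N k l : ℕ} (hN : k + l = N) {f h : Fin k → Fin N}
    {g : Fin l → Fin N} (hf : Function.Injective f) (hh : Function.Injective h)
    (hg : Function.Injective g) (hfg : Disjoint (range f) (range g))
    (hhg : Disjoint (range h) (range g)) : ∃ σ : Equiv.Perm (Fin k), f = h ∘ σ := by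
  have key : ∀ f : Fin k → Fin N, Function.Injective f → Disjoint (range f) (range g) →
      range f = (range g)ᶜ := by
    intro f hf hfg
    -- A set of `k` indices that avoids the `l = N - k` values of `g` must be their whole
    -- complement; this determines the range, and leaves only the order free.
    refine Set.eq_of_subset_of_ncard_le (subset_compl_iff_disjoint_right.2 hfg) ?_
    rw [Set.ncard_compl, Set.ncard_range_of_injective hg, Set.ncard_range_of_injective hf]
    simp
    omega
  have hr : range f = range h := (key f hf hfg).trans (key h hh hhg).symm
  refine ⟨(Equiv.ofInjective f hf).trans ((Equiv.setCongr hr).trans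
    (Equiv.ofInjective h hh).symm), ?_⟩
  funext i
  simp only [Function.comp_apply, Equiv.trans_apply, Equiv.apply_ofInjective_symm,
    Equiv.setCongr_apply, Equiv.ofInjective_apply]

/-- A symmetric function of multi-indices supported on the injective enumerations of the complement
of the range of `g` sums up to `k!` times its value at such an enumeration. -/
theorem sum_multiIndex_eq {N k l : ℕ} (hN : k + l = N) {h : Fin k → Fin N} {g : Fin l → Fin N}
    (hh : Function.Injective h) (hg : Function.Injective g) (hhg : Disjoint (range h) (range g))
    (F : (Fin k → Fin N) → ℝ) (hF : ∀ σ : Equiv.Perm (Fin k), F (h ∘ σ) = F h)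
    (hF0 : ∀ f, F f ≠ 0 → Function.Injective f ∧ Disjoint (range f) (range g)) :
    ∑ f, F f = k.factorial * F h := by
  have hinj : Function.Injective fun σ : Equiv.Perm (Fin k) => h ∘ σ := by
    intro σ τ hστ
    exact Equiv.ext fun i => hh (congrFun hστ i)
  have : ∑ f, F f = ∑ f ∈ Finset.univ.map ⟨fun σ : Equiv.Perm (Fin k) => h ∘ σ, hinj⟩, F f := by
    symm
    refine Finset.sum_subset (Finset.subset_univ _) fun f _ hf => ?_
    by_contra hne
    obtain ⟨h1, h2⟩ := hF0 f hne
    obtain ⟨σ, rfl⟩ := exists_perm_of_disjoint_range hN h1 hh hg h2 hhg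
    exact hf (Finset.mem_map_of_mem _ (Finset.mem_univ σ))
  rw [this, Finset.sum_map]
  simp only [Function.Embedding.coeFn_mk, hF, Finset.sum_const, Finset.card_univ,
    Fintype.card_perm, Fintype.card_fin, nsmul_eq_mul]

theorem exists_complement {N k l : ℕ} (hN : k + l = N) {h : Fin k → Fin N}
    (hh : Function.Injective h) :
    ∃ g : Fin l → Fin N, Function.Injective g ∧ Disjoint (range g) (range h) := by
  have hc : Fintype.card {i // i ∉ Finset.univ.image h} = l := by
    rw [Fintype.card_subtype_compl, Fintype.card_coe, Finset.card_image_of_injective _ hh]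
    simp
    omega
  refine ⟨fun i => ((Fintype.equivFinOfCardEq hc).symm i).1, fun i j hij => ?_, ?_⟩
  · exact (Fintype.equivFinOfCardEq hc).symm.injective (Subtype.ext hij)
  · rw [Set.disjoint_left]
    rintro _ ⟨i, rfl⟩ ⟨j, hj⟩
    exact ((Fintype.equivFinOfCardEq hc).symm i).2
      (Finset.mem_image.2 ⟨j, Finset.mem_univ j, hj⟩)

theorem append_injective_iff {N k l : ℕ} {f : Fin k → Fin N} {g : Fin l → Fin N} :
    Function.Injective (Fin.append f g) ↔
      Function.Injective f ∧ Function.Injective g ∧ Disjoint (range f) (range g) := by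
  rw [Fin.append_injective_iff, Set.disjoint_left]
  simp only [mem_range, forall_exists_index, forall_apply_eq_imp_iff, not_exists]
  refine and_congr_right fun _ => and_congr_right fun _ => ?_
  exact forall_congr' fun i => forall_congr' fun j => ne_comm

variable {V : Type*} [NormedAddCommGroup V] [InnerProductSpace ℝ V] [FiniteDimensional ℝ V]

/-- The sign of the permutation exchanging the first `k` and the last `l` arguments. -/
def swapSign (k l : ℕ) : ℝ :=
  ((Equiv.Perm.sign (finAddFlip.trans (finCongr (Nat.add_comm l k)) :
    Equiv.Perm (Fin (k + l))) : ℤ) : ℝ)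

/-- The value `(-1)^{kl}` of the sign is never needed, only that it squares to one. -/
theorem swapSign_mul_self (k l : ℕ) : swapSign k l * swapSign k l = 1 := by
  rw [swapSign, ← Int.cast_mul, Int.units_coe_mul_self, Int.cast_one]

theorem append_swap {W : Type*} [AddCommGroup W] [Module ℝ W] {k l n : ℕ} (h : k + l = n)
    (h' : l + k = n) (τ : W [⋀^Fin n]→ₗ[ℝ] ℝ) (u : Fin k → W) (v : Fin l → W) :
    τ (Fin.append v u ∘ Fin.cast h'.symm) = swapSign k l * τ (Fin.append u v ∘ Fin.cast h.symm) := by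
  subst h
  have h1 := τ.map_perm (Fin.append v u ∘ Fin.cast h'.symm)
    (finAddFlip.trans (finCongr (Nat.add_comm l k)))
  have h2 : (Fin.append v u ∘ Fin.cast h'.symm) ∘
      (finAddFlip.trans (finCongr (Nat.add_comm l k))) = Fin.append u v ∘ Fin.cast rfl := by
    funext j
    refine Fin.addCases (fun a => ?_) (fun a => ?_) j <;> simp
  rw [h2] at h1
  rw [h1, Units.smul_def, zsmul_eq_mul, ← swapSign, ← mul_assoc, swapSign_mul_self, one_mul]

/-- A top degree form taking the values `±1` on orthonormal bases. -/
def IsUnitVolume {n : ℕ} (τ : V [⋀^Fin n]→ₗ[ℝ] ℝ) : Prop :=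
  ∀ e : OrthonormalBasis (Fin n) ℝ V, |τ e| = 1

theorem freezeFirst_apply {W : Type*} [AddCommGroup W] [Module ℝ W] {k l n : ℕ} (h : k + l = n)
    (τ : W [⋀^Fin n]→ₗ[ℝ] ℝ) (u : Fin k → W) (v : Fin l → W) :
    freezeFirst h τ u v = τ (Fin.append u v ∘ Fin.cast h.symm) := rfl

theorem altStar_apply {k l n : ℕ} (h : k + l = n) (τ : V [⋀^Fin n]→ₗ[ℝ] ℝ)
    (α : V [⋀^Fin k]→ₗ[ℝ] ℝ) (v : Fin l → V) :
    altStar h τ α v = (k.factorial : ℝ)⁻¹ * ∑ f : Fin k → Fin (Module.finrank ℝ V),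
      α (stdOrthonormalBasis ℝ V ∘ f) *
        τ (Fin.append (stdOrthonormalBasis ℝ V ∘ f) v ∘ Fin.cast h.symm) := by
  change ((k.factorial : ℝ)⁻¹ • ∑ f : Fin k → Fin (Module.finrank ℝ V), _ •
      freezeFirst h τ _ : V [⋀^Fin l]→ₗ[ℝ] ℝ) v = _
  rw [AlternatingMap.smul_apply, smul_eq_mul]
  congr 1
  exact map_sum (⟨⟨fun γ : V [⋀^Fin l]→ₗ[ℝ] ℝ => γ v, rfl⟩, fun _ _ => rfl⟩ :
    (V [⋀^Fin l]→ₗ[ℝ] ℝ) →+ ℝ) _ _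

/-- The Hodge star as an inner product. -/
theorem altStar_apply_eq_altInner {k l n : ℕ} (h : k + l = n) (h' : l + k = n)
    (τ : V [⋀^Fin n]→ₗ[ℝ] ℝ) (α : V [⋀^Fin k]→ₗ[ℝ] ℝ) (v : Fin l → V) :
    altStar h τ α v = swapSign l k * altInner α (freezeFirst h' τ v) := by
  rw [altStar_apply, altInner, mul_left_comm, Finset.mul_sum Finset.univ _ (swapSign l k)]
  congr 1
  refine Finset.sum_congr rfl fun f _ => ?_
  rw [freezeFirst_apply, append_swap h' h, mul_left_comm]
  rfl

theorem altInner_comm {k : ℕ} (α β : V [⋀^Fin k]→ₗ[ℝ] ℝ) : altInner α β = altInner β α := by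
  simp only [altInner, mul_comm]

/-- The Hodge star is, up to sign, its own adjoint. -/
theorem altInner_altStar {k l n : ℕ} (h : k + l = n) (h' : l + k = n)
    (τ : V [⋀^Fin n]→ₗ[ℝ] ℝ) (α : V [⋀^Fin k]→ₗ[ℝ] ℝ) (β : V [⋀^Fin l]→ₗ[ℝ] ℝ) :
    altInner (altStar h τ α) β = swapSign k l * altInner α (altStar h' τ β) := by
  -- Both sides of the adjointness relation are the same double sum over `f` and `g`, except that
  -- the arguments of `τ` appear as `(e_f, e_g)` on one side and as `(e_g, e_f)` on the other.
  have e1 : altInner (altStar h τ α) β = (l.factorial : ℝ)⁻¹ * ((k.factorial : ℝ)⁻¹ *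
      ∑ g : Fin l → Fin (Module.finrank ℝ V), ∑ f : Fin k → Fin (Module.finrank ℝ V),
        α (stdOrthonormalBasis ℝ V ∘ f) * β (stdOrthonormalBasis ℝ V ∘ g) *
          τ (Fin.append (stdOrthonormalBasis ℝ V ∘ f) (stdOrthonormalBasis ℝ V ∘ g) ∘
            Fin.cast h.symm)) := by
    rw [altInner, Finset.mul_sum (s := Finset.univ) (a := (k.factorial : ℝ)⁻¹)]
    congr 1
    refine Finset.sum_congr rfl fun g _ => ?_
    rw [altStar_apply, mul_assoc, Finset.sum_mul]
    congr 1
    refine Finset.sum_congr rfl fun f _ => ?_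
    simp only [Function.comp_def]
    ring
  have e2 : altInner α (altStar h' τ β) = (k.factorial : ℝ)⁻¹ * ((l.factorial : ℝ)⁻¹ *
      ∑ f : Fin k → Fin (Module.finrank ℝ V), ∑ g : Fin l → Fin (Module.finrank ℝ V),
        α (stdOrthonormalBasis ℝ V ∘ f) * β (stdOrthonormalBasis ℝ V ∘ g) *
          τ (Fin.append (stdOrthonormalBasis ℝ V ∘ g) (stdOrthonormalBasis ℝ V ∘ f) ∘
            Fin.cast h'.symm)) := by
    rw [altInner, Finset.mul_sum (s := Finset.univ) (a := (l.factorial : ℝ)⁻¹)]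
    congr 1
    refine Finset.sum_congr rfl fun f _ => ?_
    rw [altStar_apply, mul_left_comm, Finset.mul_sum]
    congr 1
    refine Finset.sum_congr rfl fun g _ => ?_
    simp only [Function.comp_def]
    ring
  rw [e1, e2, Finset.sum_comm]
  simp only [append_swap h h', Finset.mul_sum]
  refine Finset.sum_congr rfl fun f _ => Finset.sum_congr rfl fun g _ => ?_
  have := swapSign_mul_self k l
  linear_combination (-1 : ℝ) * ((l.factorial : ℝ)⁻¹ * ((k.factorial : ℝ)⁻¹ *
    (α (stdOrthonormalBasis ℝ V ∘ f) * β (stdOrthonormalBasis ℝ V ∘ g) *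
      τ (Fin.append (stdOrthonormalBasis ℝ V ∘ f) (stdOrthonormalBasis ℝ V ∘ g) ∘
        Fin.cast h.symm)))) * this

theorem IsUnitVolume.sq_eq_one {n : ℕ} {τ : V [⋀^Fin n]→ₗ[ℝ] ℝ} (hτ : IsUnitVolume τ)
    (hn : Module.finrank ℝ V = n) {F : Fin n → Fin (Module.finrank ℝ V)}
    (hF : Function.Injective F) : τ (stdOrthonormalBasis ℝ V ∘ F) ^ 2 = 1 := by
  have hb : Function.Bijective F := (Fintype.bijective_iff_injective_and_card F).2 ⟨hF, by simp [hn]⟩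
  have h1 := hτ ((stdOrthonormalBasis ℝ V).reindex (Equiv.ofBijective F hb).symm)
  have h2 : ((stdOrthonormalBasis ℝ V).reindex (Equiv.ofBijective F hb).symm : Fin n → V)
      = stdOrthonormalBasis ℝ V ∘ F := by
    rw [OrthonormalBasis.coe_reindex]
    rfl
  rw [h2] at h1
  rw [← sq_abs, h1, one_pow]

/-- Evaluate on basis vectors `e_q` with `q` injective. If `τ(e_q, e_g) ≠ 0`, then only the `k!`
rearrangements of `q` contribute to `(⋆α)(e_g)`, and they contribute equally, so `(⋆α)(e_g) = α(e_q)
τ(e_q, e_g)`. In the second star this is multiplied by `τ(e_g, e_q)`, which is `τ(e_q, e_g)` up to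
the block-swap sign. The resulting squares are `1` for the `l!` enumerations `g` of the complement
of `q` and `0` otherwise. -/
theorem altStar_altStar {k l n : ℕ} (h : k + l = n) (h' : l + k = n)
    (hn : Module.finrank ℝ V = n) {τ : V [⋀^Fin n]→ₗ[ℝ] ℝ} (hτ : IsUnitVolume τ)
    (α : V [⋀^Fin k]→ₗ[ℝ] ℝ) : altStar h' τ (altStar h τ α) = swapSign k l • α := by
  set b := stdOrthonormalBasis ℝ V with hb
  have hcomp : ∀ {a c : ℕ} (f : Fin a → Fin (Module.finrank ℝ V))
      (g : Fin c → Fin (Module.finrank ℝ V)),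
      Fin.append (b ∘ f) (b ∘ g) = b ∘ Fin.append f g := by
    intro a c f g
    funext j
    refine Fin.addCases (fun i => ?_) (fun i => ?_) j <;> simp
  have hzero : ∀ (f : Fin k → Fin (Module.finrank ℝ V)) (g : Fin l → Fin (Module.finrank ℝ V)),
      τ (Fin.append (b ∘ f) (b ∘ g) ∘ Fin.cast h.symm) ≠ 0 →
        Function.Injective f ∧ Function.Injective g ∧ Disjoint (range f) (range g) := by
    intro f g hne
    rw [← append_injective_iff]
    by_contra hinj
    refine hne ?_
    rw [Function.Injective] at hinj
    push Not at hinj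
    obtain ⟨i, j, hij, hne⟩ := hinj
    refine τ.map_eq_zero_of_eq _ (i := Fin.cast h i) (j := Fin.cast h j) ?_ ?_
    · simp only [Function.comp_apply, Fin.cast_cast, Fin.cast_eq_self, hcomp, hij]
    · exact fun H => hne (Fin.cast_injective h H)
  have hone : ∀ (f : Fin k → Fin (Module.finrank ℝ V)) (g : Fin l → Fin (Module.finrank ℝ V)),
      Function.Injective f → Function.Injective g → Disjoint (range f) (range g) →
      τ (Fin.append (b ∘ f) (b ∘ g) ∘ Fin.cast h.symm) ^ 2 = 1 := by
    intro f g hf hg hfg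
    rw [hcomp, Function.comp_assoc]
    exact hτ.sq_eq_one hn ((append_injective_iff.2 ⟨hf, hg, hfg⟩).comp (Fin.cast_injective _))
  refine b.toBasis.ext_alternating fun q hq => ?_
  have hbq : (fun i => b.toBasis (q i)) = b ∘ q := by funext i; simp
  rw [hbq, altStar_apply, ← hb]
  have step : ∀ g : Fin l → Fin (Module.finrank ℝ V), altStar h τ α (b ∘ g) *
      τ (Fin.append (b ∘ g) (b ∘ q) ∘ Fin.cast h'.symm) = swapSign k l * α (b ∘ q) *
        τ (Fin.append (b ∘ q) (b ∘ g) ∘ Fin.cast h.symm) ^ 2 := by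
    intro g
    rw [append_swap h h']
    by_cases h0 : τ (Fin.append (b ∘ q) (b ∘ g) ∘ Fin.cast h.symm) = 0
    · rw [h0]; ring
    obtain ⟨-, hg, hqg⟩ := hzero q g h0
    have key := sum_multiIndex_eq (h.trans hn.symm) hq hg hqg
      (fun f => α (b ∘ f) * τ (Fin.append (b ∘ f) (b ∘ g) ∘ Fin.cast h.symm)) ?_ ?_
    · rw [altStar_apply, ← hb, key]
      have := k.factorial_ne_zero
      field_simp
    · intro σ
      have e1 : α (b ∘ q ∘ σ) = Equiv.Perm.sign σ • α (b ∘ q) := α.map_perm (b ∘ q) σ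
      -- The block to be permuted is the first one, while `freezeFirst` lets only the last one vary.
      -- The signed block swap exhibits `f ↦ τ(e_f, e_g)` as an alternating form.
      have e2 : freezeFirst h' ((swapSign k l) • τ) (b ∘ g) (b ∘ q ∘ σ) =
          Equiv.Perm.sign σ • freezeFirst h' ((swapSign k l) • τ) (b ∘ g) (b ∘ q) :=
        AlternatingMap.map_perm _ (b ∘ q) σ
      simp only [freezeFirst_apply, AlternatingMap.smul_apply, smul_eq_mul, append_swap h h',
        ← mul_assoc, swapSign_mul_self, one_mul] at e2
      simp only [e1, e2, Units.smul_def, zsmul_eq_mul]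
      have e3 : (((Equiv.Perm.sign σ : ℤ) : ℝ)) * ((Equiv.Perm.sign σ : ℤ) : ℝ) = 1 := by
        rw [← Int.cast_mul, Int.units_coe_mul_self, Int.cast_one]
      linear_combination α (b ∘ q) * τ (Fin.append (b ∘ q) (b ∘ g) ∘ Fin.cast h.symm) * e3
    · intro f hf
      obtain ⟨h1, -, h2⟩ := hzero f g (right_ne_zero_of_mul hf)
      exact ⟨h1, h2⟩
  obtain ⟨g₀, hg₀, hdis⟩ := exists_complement (h.trans hn.symm) hq
  have key := sum_multiIndex_eq (h'.trans hn.symm) hg₀ hq hdis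
    (fun g => τ (Fin.append (b ∘ q) (b ∘ g) ∘ Fin.cast h.symm) ^ 2) ?_ ?_
  · simp only [step, ← Finset.mul_sum, key, hone q g₀ hq hg₀ hdis.symm, AlternatingMap.smul_apply,
      smul_eq_mul]
    have := l.factorial_ne_zero
    field_simp
  · intro σ
    have : range (g₀ ∘ σ) = range g₀ := σ.surjective.range_comp g₀
    exact (hone q _ hq (hg₀.comp σ.injective) (by rw [this]; exact hdis.symm)).trans
      (hone q _ hq hg₀ hdis.symm).symm
  · intro g hg
    obtain ⟨-, h1, h2⟩ := hzero q g (fun H => hg (by simp only [H]; norm_num))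
    exact ⟨h1, h2.symm⟩

theorem altInner_smul_right {k : ℕ} (c : ℝ) (α γ : V [⋀^Fin k]→ₗ[ℝ] ℝ) :
    altInner α (c • γ) = c * altInner α γ := by
  rw [altInner_comm, altInner_smul_left, altInner_comm]

/-- `⟨⋆α, ⋆α⟩ = ε ⟨α, ⋆⋆α⟩ = ε² ⟨α, α⟩`. -/
theorem altNorm_altStar {k l n : ℕ} (h : k + l = n) (hn : Module.finrank ℝ V = n)
    {τ : V [⋀^Fin n]→ₗ[ℝ] ℝ} (hτ : IsUnitVolume τ) (α : V [⋀^Fin k]→ₗ[ℝ] ℝ) :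
    altNorm (altStar h τ α) = altNorm α := by
  have h' : l + k = n := by omega
  rw [altNorm, altNorm, altInner_altStar h h', altStar_altStar h h' hn hτ, altInner_smul_right,
    ← mul_assoc, swapSign_mul_self, one_mul]

/-- Replaces the sum over shuffles, which are classes of permutations, by a sum over all
permutations; each class has `k! l!` elements. -/
theorem altWedge_apply {W : Type*} [AddCommGroup W] [Module ℝ W] {k l : ℕ}
    (α : W [⋀^Fin k]→ₗ[ℝ] ℝ) (β : W [⋀^Fin l]→ₗ[ℝ] ℝ) (v : Fin (k + l) → W) :
    (k.factorial * l.factorial : ℝ) * altWedge α β v = ∑ σ : Equiv.Perm (Fin k ⊕ Fin l),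
      ((Equiv.Perm.sign σ : ℤ) : ℝ) * (α (fun i => v (finSumFinEquiv (σ (Sum.inl i)))) *
        β (fun i => v (finSumFinEquiv (σ (Sum.inr i))))) := by
  have h1 := congrArg (fun γ => LinearMap.mul' ℝ ℝ (γ (v ∘ finSumFinEquiv)))
    (MultilinearMap.domCoprod_alternization_eq α β)
  simp only [MultilinearMap.alternatization_apply, AlternatingMap.smul_apply, map_sum,
    MultilinearMap.domDomCongr_apply, map_nsmul, Fintype.card_fin] at h1
  have h2 : altWedge α β v = LinearMap.mul' ℝ ℝ (α.domCoprod β (v ∘ finSumFinEquiv)) := rfl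
  rw [h2, ← Nat.cast_mul, ← nsmul_eq_mul, ← h1]
  refine Finset.sum_congr rfl fun σ _ => ?_
  rw [Units.smul_def, map_zsmul, zsmul_eq_mul, MultilinearMap.domCoprod_apply]
  simp [LinearMap.mul'_apply]

/-- The pairing of complementary degrees by the exterior product is the inner product with the
Hodge star: `α ∧ β = ⟨⋆α, β⟩ τ`. -/
theorem altInner_altWedge {k l n : ℕ} (h : k + l = n) (τ : V [⋀^Fin n]→ₗ[ℝ] ℝ)
    (α : V [⋀^Fin k]→ₗ[ℝ] ℝ) (β : V [⋀^Fin l]→ₗ[ℝ] ℝ) :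
    altInner ((altWedge α β).domDomCongr (finCongr h)) τ = altInner (altStar h τ α) β := by
  subst h
  set b := stdOrthonormalBasis ℝ V with hb
  set T : (Fin (k + l) → Fin (Module.finrank ℝ V)) → ℝ := fun F =>
    α (fun i => b (F (Fin.castAdd l i))) * β (fun i => b (F (Fin.natAdd k i))) *
      τ (fun i => b (F i)) with hT
  -- Reindexing the multi-indices by `σ` moves the permutation from `α` and `β` onto `τ`. The sign
  -- that `τ` then yields cancels the sign of `σ`, so all `(k + l)!` permutations contribute the
  -- same sum.
  have hperm : ∀ σ : Equiv.Perm (Fin k ⊕ Fin l),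
      ∑ F : Fin (k + l) → Fin (Module.finrank ℝ V), ((Equiv.Perm.sign σ : ℤ) : ℝ) *
        (α (fun i => b (F (finSumFinEquiv (σ (Sum.inl i))))) *
          β (fun i => b (F (finSumFinEquiv (σ (Sum.inr i)))))) * τ (fun i => b (F i))
        = ∑ F, T F := by
    intro σ
    let ρ : Equiv.Perm (Fin (k + l)) := finSumFinEquiv.permCongr σ
    rw [← Equiv.sum_comp (Equiv.arrowCongr ρ (Equiv.refl (Fin (Module.finrank ℝ V))))]
    refine Finset.sum_congr rfl fun F _ => ?_
    have e1 : τ (fun i => b (F (ρ.symm i))) = ((Equiv.Perm.sign σ : ℤ) : ℝ) * τ (fun i => b (F i)) := by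
      have := τ.map_perm (fun i => b (F i)) ρ.symm
      rw [Equiv.Perm.sign_symm, Equiv.Perm.sign_permCongr, Units.smul_def, zsmul_eq_mul] at this
      exact this
    have e3 : (((Equiv.Perm.sign σ : ℤ) : ℝ)) * ((Equiv.Perm.sign σ : ℤ) : ℝ) = 1 := by
      rw [← Int.cast_mul, Int.units_coe_mul_self, Int.cast_one]
    have e4 : ∀ j, F (ρ.symm (finSumFinEquiv (σ j))) = F (finSumFinEquiv j) := by
      intro j
      simp [ρ, Equiv.permCongr_def]
    simp only [Equiv.arrowCongr_apply, Equiv.coe_refl, Function.comp_apply, id, e1, hT, e4,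
      finSumFinEquiv_apply_left, finSumFinEquiv_apply_right]
    linear_combination (α (fun i => b (F (Fin.castAdd l i))) *
      β (fun i => b (F (Fin.natAdd k i))) * τ (fun i => b (F i))) * e3
  have e1 : (k.factorial * l.factorial : ℝ) * ∑ F : Fin (k + l) → Fin (Module.finrank ℝ V),
      altWedge α β (fun i => b (F i)) * τ (fun i => b (F i)) = (k + l).factorial * ∑ F, T F := by
    rw [Finset.mul_sum]
    simp only [← mul_assoc, altWedge_apply, Finset.sum_mul]
    rw [Finset.sum_comm]
    simp only [← mul_assoc] at hperm
    simp only [hperm, Finset.sum_const, Finset.card_univ, Fintype.card_perm, Fintype.card_sum,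
      Fintype.card_fin, nsmul_eq_mul]
  have e2 : altInner (altStar rfl τ α) β = (l.factorial : ℝ)⁻¹ * ((k.factorial : ℝ)⁻¹ *
      ∑ F, T F) := by
    rw [← Equiv.sum_comp (Fin.appendEquiv k l), Fintype.sum_prod_type, Finset.sum_comm, altInner,
      Finset.mul_sum (s := Finset.univ) (a := (k.factorial : ℝ)⁻¹)]
    congr 1
    refine Finset.sum_congr rfl fun g _ => ?_
    rw [altStar_apply, mul_assoc, Finset.sum_mul]
    congr 1
    refine Finset.sum_congr rfl fun f _ => ?_
    have e3 : Fin.append (b ∘ f) (fun i => b (g i)) ∘ Fin.cast rfl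
        = fun i => b (Fin.append f g i) := by
      funext j
      refine Fin.addCases (fun i => ?_) (fun i => ?_) j <;> simp
    simp only [← hb]
    rw [e3]
    simp only [hT, Fin.appendEquiv, Equiv.coe_fn_mk, Fin.append_left, Fin.append_right,
      Function.comp_def]
    ring
  have e5 : altInner ((altWedge α β).domDomCongr (finCongr rfl)) τ = ((k + l).factorial : ℝ)⁻¹ *
      ∑ F : Fin (k + l) → Fin (Module.finrank ℝ V),
        altWedge α β (fun i => b (F i)) * τ (fun i => b (F i)) := rfl
  rw [e5, e2]
  have hk : (k.factorial : ℝ) ≠ 0 := by exact_mod_cast k.factorial_ne_zero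
  have hl : (l.factorial : ℝ) ≠ 0 := by exact_mod_cast l.factorial_ne_zero
  have hkl : ((k + l).factorial : ℝ) ≠ 0 := by exact_mod_cast (k + l).factorial_ne_zero
  field_simp
  linear_combination e1

end HodgeStar

/-! ### Measurability of the volume form and of the Hodge star -/

section VolumeForm

variable {V : Type*} [NormedAddCommGroup V] [InnerProductSpace ℝ V] {n : ℕ}
  [hn : Fact (Module.finrank ℝ V = n)]

theorem isUnitVolume_volumeForm [FiniteDimensional ℝ V] (o : Orientation ℝ V (Fin n)) :
    IsUnitVolume o.volumeForm := fun e => o.abs_volumeForm_apply_of_orthonormal e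

/-- The volume form of the orientation of a basis takes on this basis the square root of the Gram
determinant as its value. -/
theorem volumeForm_basis_orientation (X : Module.Basis (Fin n) ℝ V) :
    X.orientation.volumeForm X = √(Matrix.of fun i j => inner ℝ (X i) (X j)).det := by
  -- An orthonormal basis adapted to an orientation is only available for `n > 0`. For `n = 0` both
  -- sides are `1`.
  rcases Nat.eq_zero_or_pos n with rfl | hpos
  · have : X.orientation = Module.Oriented.positiveOrientation (R := ℝ) := by
      exact X.orientation_isEmpty
    rw [this, Orientation.volumeForm_zero_pos]
    simp
  · set b := X.orientation.finOrthonormalBasis hpos hn.out with hb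
    have hor : b.toBasis.orientation = X.orientation :=
      X.orientation.finOrthonormalBasis_orientation hpos hn.out
    have hpos' : 0 < b.toBasis.det X := (b.toBasis.orientation_eq_iff_det_pos X).1 hor
    -- The Gram matrix is `AᵀA`, where `A` expresses `X` in an orthonormal basis of the same
    -- orientation; hence `det A > 0` is the square root of its determinant.
    have hG : (Matrix.of fun i j => inner ℝ (X i) (X j))
        = (b.toBasis.toMatrix X).transpose * b.toBasis.toMatrix X := by
      ext i j
      rw [Matrix.mul_apply, Matrix.of_apply, ← b.sum_inner_mul_inner (X i) (X j)]
      refine Finset.sum_congr rfl fun m _ => ?_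
      simp [Module.Basis.toMatrix_apply, OrthonormalBasis.repr_apply_apply, real_inner_comm]
    rw [X.orientation.volumeForm_robust b hor, hG, Matrix.det_mul, Matrix.det_transpose,
      ← Module.Basis.det_apply, Real.sqrt_mul_self hpos'.le]

end VolumeForm

section Manifold

set_option linter.unusedSectionVars false

variable {n : ℕ} {M : Type*} [EMetricSpace M] [ChartedSpace (EuclideanSpace ℝ (Fin n)) M]
  [IsManifold (𝓡 n) ∞ M] [RiemannianBundle (fun x : M => TangentSpace (𝓡 n) x)]

/-- Near each point the volume form is, up to a constant sign, the square root of the Gram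
determinant. -/
theorem exists_volForm_coordFrame (o : ManifoldOrientation n M) (y : M) :
    ∃ c : ℝ, ∀ᶠ x in 𝓝 y,
      volForm o x (fun i => coordFrame y x (EuclideanSpace.basisFun (Fin n) ℝ i))
        = c * √(gramMatrix (n := n) y x).det := by
  obtain ⟨U, hU, hUs, o₀, ho⟩ := o.locally_constant y
  set E := (EuclideanSpace.basisFun (Fin n) ℝ).toBasis with hE
  let e := trivializationAt (EuclideanSpace ℝ (Fin n)) (TangentSpace (𝓡 n) (M := M)) y
  have hX : ∀ (x : M) (hx : x ∈ U), ∃ X : Module.Basis (Fin n) ℝ (TangentSpace (𝓡 n) x),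
      (∀ i, X i = coordFrame y x (EuclideanSpace.basisFun (Fin n) ℝ i)) ∧
      Orientation.map (Fin n) (e.continuousLinearEquivAt ℝ x (hUs hx)).toLinearEquiv X.orientation
        = E.orientation := by
    intro x hx
    refine ⟨E.map (e.continuousLinearEquivAt ℝ x (hUs hx)).toLinearEquiv.symm, fun i => ?_, ?_⟩
    · rw [coordFrame, Trivialization.symmL_apply _ (hUs hx)]
      simp [hE, e]
    · rw [Module.Basis.orientation_map, ← Orientation.map_symm, Equiv.apply_symm_apply]
  have hval : ∀ (x : M) (X : Module.Basis (Fin n) ℝ (TangentSpace (𝓡 n) x)),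
      (∀ i, X i = coordFrame y x (EuclideanSpace.basisFun (Fin n) ℝ i)) →
      X.orientation.volumeForm (fun i => coordFrame y x (EuclideanSpace.basisFun (Fin n) ℝ i))
        = √(gramMatrix (n := n) y x).det := by
    intro x X hX
    have := volumeForm_basis_orientation X
    simp only [gramMatrix, ← hX]
    exact this
  -- The constant is `1` or `-1` according to whether `o₀` is the standard orientation of `ℝⁿ` or
  -- its opposite. It serves all of `U` because `o₀` does not depend on the point.
  rcases E.orientation_eq_or_eq_neg o₀ with h | h
  · refine ⟨1, mem_of_superset hU fun x hx => ?_⟩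
    obtain ⟨X, hX1, hX2⟩ := hX x hx
    have : o.at_point x = X.orientation :=
      (Orientation.map (Fin n) (e.continuousLinearEquivAt ℝ x (hUs hx)).toLinearEquiv).injective
        ((ho x hx).trans (h.trans hX2.symm))
    rw [mem_ofPred_eq, volForm, this, hval x X hX1, one_mul]
  · refine ⟨-1, mem_of_superset hU fun x hx => ?_⟩
    obtain ⟨X, hX1, hX2⟩ := hX x hx
    have : o.at_point x = -X.orientation := by
      refine (Orientation.map (Fin n)
        (e.continuousLinearEquivAt ℝ x (hUs hx)).toLinearEquiv).injective ?_
      rw [Orientation.map_neg, hX2]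
      exact (ho x hx).trans h
    rw [mem_ofPred_eq, volForm, this, Orientation.volumeForm_neg_orientation,
      AlternatingMap.neg_apply, hval x X hX1, neg_one_mul]

variable [MeasurableSpace M] [BorelSpace M] [IsContMDiffRiemannianBundle (𝓡 n) ∞ (EuclideanSpace ℝ (Fin n))
  (fun x : M => TangentSpace (𝓡 n) x)]

/-- The components of the volume form in a chart are continuous. -/
theorem continuousOn_volForm (o : ManifoldOrientation n M) (x₀ : M)
    (v : Fin n → EuclideanSpace ℝ (Fin n)) :
    ContinuousOn (fun x => volForm o x (fun i => coordFrame x₀ x (v i)))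
      (chartAt (EuclideanSpace ℝ (Fin n)) x₀).source := by
  intro y hy
  refine ContinuousAt.continuousWithinAt ?_
  obtain ⟨c, hc⟩ := exists_volForm_coordFrame o y
  let e := trivializationAt (EuclideanSpace ℝ (Fin n)) (TangentSpace (𝓡 n) (M := M)) x₀
  let e' := trivializationAt (EuclideanSpace ℝ (Fin n)) (TangentSpace (𝓡 n) (M := M)) y
  set E := (EuclideanSpace.basisFun (Fin n) ℝ).toBasis with hE
  have hey : y ∈ e.baseSet := by simpa [e] using hy
  have hey' : y ∈ e'.baseSet := by simp [e']
  have hsrc : (chartAt (EuclideanSpace ℝ (Fin n)) y).source ∈ 𝓝 y := chart_source_mem_nhds _ y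
  -- The sign is controlled near `y` in the trivialization at `y`, whereas the components refer to
  -- the one at `x₀`. For a top degree form the passage between them is the determinant of the
  -- coordinate change applied to `v`.
  have heq : ∀ᶠ x in 𝓝 y, volForm o x (fun i => coordFrame x₀ x (v i))
      = E.det (fun i => e.coordChangeL ℝ e' x (v i)) * (c * √(gramMatrix (n := n) y x).det) := by
    filter_upwards [hc, e.open_baseSet.mem_nhds hey, e'.open_baseSet.mem_nhds hey'] with x hx h1 h2
    have h3 : ∀ w, coordFrame x₀ x w = coordFrame y x (e.coordChangeL ℝ e' x w) := by
      intro w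
      rw [coordFrame, coordFrame, Trivialization.symmL_apply _ h1, Trivialization.symmL_apply _ h2]
      rw [e.coordChangeL_apply (R := ℝ) e' ⟨h1, h2⟩, e'.symm_apply_apply_mk h2]
    have h4 := congrArg (fun γ => γ (fun i => e.coordChangeL ℝ e' x (v i)))
      (((volForm o x).compLinearMap (coordFrame y x).toLinearMap).eq_smul_basis_det E)
    simp only [AlternatingMap.compLinearMap_apply, AlternatingMap.smul_apply, smul_eq_mul] at h4
    simp only [h3]
    rw [← hx, mul_comm]
    simpa [hE] using h4
  refine ContinuousAt.congr ?_ (heq.mono fun _ h => h.symm)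
  have hG : ContinuousAt (fun x => gramMatrix (n := n) y x) y :=
    continuousAt_pi.2 fun i => continuousAt_pi.2 fun j =>
      (continuousOn_gramMatrix y i j).continuousAt hsrc
  have hdet : ContinuousAt (fun x => (gramMatrix (n := n) y x).det) y :=
    (continuous_id.matrix_det).continuousAt.comp hG
  refine ContinuousAt.mul ?_ (continuousAt_const.mul hdet.sqrt)
  have hA : ContinuousAt (fun x => (e.coordChangeL ℝ e' x :
      EuclideanSpace ℝ (Fin n) →L[ℝ] EuclideanSpace ℝ (Fin n))) y :=
    (continuousOn_coordChange ℝ e e').continuousAt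
      ((e.open_baseSet.inter e'.open_baseSet).mem_nhds ⟨hey, hey'⟩)
  simp only [Module.Basis.det_apply]
  refine (continuous_id.matrix_det).continuousAt.comp ?_
  refine continuousAt_pi.2 fun i => continuousAt_pi.2 fun j => ?_
  have : ContinuousAt (fun x => (e.coordChangeL ℝ e' x :
      EuclideanSpace ℝ (Fin n) →L[ℝ] EuclideanSpace ℝ (Fin n)) (v j)) y :=
    hA.clm_apply continuousAt_const
  have h5 := ((E.coord i).continuous_of_finiteDimensional).continuousAt.comp this
  exact h5

theorem measurableForm_volForm (o : ManifoldOrientation n M) : MeasurableForm (volForm o) :=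
  fun x₀ v => (continuousOn_iff_continuous_domRestrict.1 (continuousOn_volForm o x₀ v)).measurable

/-- The orthonormal bases in the definition of the star are chosen point by point, with no
measurability in the point. Writing the star as an inner product with a frozen volume form, and that
inner product through the inverse Gram matrix of the chart, expresses its components in measurable
functions. -/
theorem MeasurableForm.altStar (o : ManifoldOrientation n M) {k l : ℕ} (h : k + l = n)
    {a : DForm n M k} (ha : MeasurableForm a) :
    MeasurableForm fun x => altStar h (volForm o x) (a x) := by
  intro x₀ v
  have h' : l + k = n := by omega
  have hG : Continuous fun x : (chartAt (EuclideanSpace ℝ (Fin n)) x₀).source =>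
      gramMatrix (n := n) x₀ x.1 :=
    continuous_matrix fun i j =>
      continuousOn_iff_continuous_domRestrict.1 (continuousOn_gramMatrix x₀ i j)
  have hGinv : ∀ i j, Measurable fun x : (chartAt (EuclideanSpace ℝ (Fin n)) x₀).source =>
      (gramMatrix (n := n) x₀ x.1)⁻¹ i j := by
    intro i j
    simp only [Matrix.inv_def, Ring.inverse_eq_inv', Matrix.smul_apply, smul_eq_mul]
    exact hG.matrix_det.measurable.inv.mul (hG.matrix_adjugate.matrix_elem i j).measurable
  have heq : (fun x : (chartAt (EuclideanSpace ℝ (Fin n)) x₀).source =>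
      _root_.altStar h (volForm o x.1) (a x.1) (fun i => coordFrame x₀ x.1 (v i))) = fun x =>
      swapSign l k * ((k.factorial : ℝ)⁻¹ * ∑ g : Fin k → Fin n, ∑ f : Fin k → Fin n,
        (∏ m, (gramMatrix (n := n) x₀ x.1)⁻¹ (g m) (f m)) *
          (a x.1 (fun i => coordFrame x₀ x.1 (EuclideanSpace.basisFun (Fin n) ℝ (g i))) *
            volForm o x.1 (fun i => coordFrame x₀ x.1 ((Fin.append v
              (fun i => EuclideanSpace.basisFun (Fin n) ℝ (f i)) ∘ Fin.cast h'.symm) i)))) := by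
    funext x
    obtain ⟨X, hX⟩ := exists_coordBasis x₀ x.1 x.2
    rw [altStar_apply_eq_altInner h h', altInner_eq_gram X]
    simp only [hX, freezeFirst_apply]
    have happ : ∀ f : Fin k → Fin n, Fin.append (fun i => coordFrame x₀ x.1 (v i))
        (fun i => coordFrame x₀ x.1 (EuclideanSpace.basisFun (Fin n) ℝ (f i))) ∘ Fin.cast h'.symm
        = fun i => coordFrame x₀ x.1 ((Fin.append v
              (fun i => EuclideanSpace.basisFun (Fin n) ℝ (f i)) ∘ Fin.cast h'.symm) i) := by
      intro f
      subst h'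
      funext j
      refine Fin.addCases (fun i => ?_) (fun i => ?_) j <;> simp
    simp only [happ]
    rfl
  rw [heq]
  refine (Measurable.const_mul ?_ _).const_mul _
  refine Finset.measurable_fun_sum _ fun g _ => Finset.measurable_fun_sum _ fun f _ => ?_
  exact (Finset.measurable_fun_prod _ fun m _ => hGinv _ _).mul
    ((ha x₀ _).mul (measurableForm_volForm o x₀ _))

end Manifold

/-! ### The Hodge star on quotients and on forms -/

section Quotient

variable {E F : Type*} [NormedAddCommGroup E] [NormedSpace ℝ E] [NormedAddCommGroup F]
  [NormedSpace ℝ F]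

/-- A linear isometric equivalence descends to quotients by corresponding subspaces. -/
theorem exists_quotient_linearIsometryEquiv (S : E ≃ₗᵢ[ℝ] F) (P : Submodule ℝ E)
    (Q : Submodule ℝ F) (h : P.map S.toLinearEquiv.toLinearMap = Q) :
    ∃ Φ : (E ⧸ P) ≃ₗᵢ[ℝ] (F ⧸ Q), ∀ z : E,
      Φ (Submodule.Quotient.mk z) = Submodule.Quotient.mk (S z) := by
  have hmk : ∀ z, Submodule.Quotient.equiv P Q S.toLinearEquiv h (Submodule.Quotient.mk z)
      = Submodule.Quotient.mk (S z) := fun z => rfl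
  refine ⟨⟨Submodule.Quotient.equiv P Q S.toLinearEquiv h, fun x => ?_⟩, hmk⟩
  -- Quotient seminorms are infima: for each inequality take a representative that is optimal up to
  -- `ε` on one side and transport it by `S` or its inverse.
  refine le_antisymm (le_of_forall_pos_le_add fun ε hε => ?_)
    (le_of_forall_pos_le_add fun ε hε => ?_)
  · obtain ⟨z, rfl, hz⟩ := Submodule.Quotient.norm_mk_lt x hε
    rw [hmk]
    refine (Submodule.Quotient.norm_mk_le Q (S z)).trans ?_
    rw [S.norm_map]
    exact hz.le
  · obtain ⟨w, hw, hw'⟩ :=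
      Submodule.Quotient.norm_mk_lt (Submodule.Quotient.equiv P Q S.toLinearEquiv h x) hε
    obtain ⟨z, rfl⟩ := S.surjective w
    rw [← hmk] at hw
    rw [← (Submodule.Quotient.equiv P Q S.toLinearEquiv h).injective hw]
    refine (Submodule.Quotient.norm_mk_le P z).trans ?_
    rw [hw, ← S.norm_map z]
    exact hw'.le

/-- A linear isometric equivalence carrying `A` onto `B` induces one of the quotients of their
closures. -/
theorem exists_closure_quotient_linearIsometryEquiv (S : E ≃ₗᵢ[ℝ] F) (A : Submodule ℝ E)
    (B : Submodule ℝ F) (h : S '' A = B) :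
    S '' A.topologicalClosure = B.topologicalClosure ∧
      ∃ Φ : (A.topologicalClosure ⧸ A.submoduleOf A.topologicalClosure) ≃ₗᵢ[ℝ]
          (B.topologicalClosure ⧸ B.submoduleOf B.topologicalClosure),
        ∀ (z : A.topologicalClosure) (w : B.topologicalClosure),
          S z = w → Φ (Submodule.Quotient.mk z) = Submodule.Quotient.mk w := by
  have hcl : S '' A.topologicalClosure = B.topologicalClosure := by
    rw [Submodule.topologicalClosure_coe, Submodule.topologicalClosure_coe, ← h]
    exact S.toHomeomorph.image_closure A
  have hmap : A.topologicalClosure.map S.toLinearEquiv.toLinearMap = B.topologicalClosure :=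
    SetLike.coe_injective hcl
  refine ⟨hcl, ?_⟩
  let R : A.topologicalClosure ≃ₗᵢ[ℝ] B.topologicalClosure :=
    ⟨S.toLinearEquiv.ofSubmodules _ _ hmap, fun z => S.norm_map z⟩
  have hR : ∀ z, (R z : F) = S z := fun z => rfl
  obtain ⟨Φ, hΦ⟩ := exists_quotient_linearIsometryEquiv R (A.submoduleOf A.topologicalClosure)
    (B.submoduleOf B.topologicalClosure) (by
      ext w
      simp only [Submodule.mem_map, Submodule.submoduleOf, Submodule.mem_comap]
      constructor
      · rintro ⟨z, hz, rfl⟩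
        exact h.subset ⟨z, hz, rfl⟩
      · intro hw
        obtain ⟨z, hz, hzw⟩ := h.superset hw
        exact ⟨⟨z, A.le_topologicalClosure hz⟩, hz, Subtype.ext hzw⟩)
  refine ⟨Φ, fun z w hzw => ?_⟩
  rw [hΦ]
  congr 1
  exact Subtype.ext hzw

end Quotient

/-! ### The star on almost everywhere classes -/

section Manifold

set_option linter.unusedSectionVars false

variable {n : ℕ} {M : Type*} [EMetricSpace M] [ChartedSpace (EuclideanSpace ℝ (Fin n)) M]
  [IsManifold (𝓡 n) ∞ M] [RiemannianBundle (fun x : M => TangentSpace (𝓡 n) x)]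
  [MeasurableSpace M] [BorelSpace M]
  [IsContMDiffRiemannianBundle (𝓡 n) ∞ (EuclideanSpace ℝ (Fin n))
    (fun x : M => TangentSpace (𝓡 n) x)]

theorem AEForm.exists_mk {k : ℕ} (a : AEForm n M k) : ∃ a' : DForm n M k, AEForm.mk a' = a :=
  Submodule.mkQ_surjective _ a

theorem AEForm.mk_eq_mk_iff {k : ℕ} {a b : DForm n M k} :
    AEForm.mk a = AEForm.mk b ↔ ∀ᵐ x ∂riemVol n M, a x = b x :=
  ⟨fun h => ae_eq_of_rel (Quotient.exact' h), fun h => Quotient.sound' (rel_of_ae_eq h)⟩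

theorem hodgeStar_mk (o : ManifoldOrientation n M) {k l : ℕ} (h : k + l = n) (a : DForm n M k) :
    hodgeStar o h (AEForm.mk a) = AEForm.mk fun x => altStar h (volForm o x) (a x) := rfl

theorem powForm_mk {k : ℕ} (p : ℝ) (a : DForm n M k) :
    powForm p (AEForm.mk a) = AEForm.mk fun x => altNorm (a x) ^ (p - 2) • a x := rfl

theorem isUnitVolume_volForm (o : ManifoldOrientation n M) (x : M) :
    IsUnitVolume (volForm o x) :=
  isUnitVolume_volumeForm (o.at_point x)

theorem altNorm_altStar_volForm (o : ManifoldOrientation n M) {k l : ℕ} (h : k + l = n) (x : M)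
    (α : TangentSpace (𝓡 n) x [⋀^Fin k]→ₗ[ℝ] ℝ) :
    altNorm (altStar h (volForm o x) α) = altNorm α :=
  altNorm_altStar (V := TangentSpace (𝓡 n) x) h finrank_euclideanSpace_fin
    (isUnitVolume_volForm o x) α

theorem hodgeStar_hodgeStar (o : ManifoldOrientation n M) {k l : ℕ} (h : k + l = n)
    (h' : l + k = n) (a : AEForm n M k) :
    hodgeStar o h' (hodgeStar o h a) = swapSign k l • a := by
  obtain ⟨a, rfl⟩ := a.exists_mk
  rw [hodgeStar_mk, hodgeStar_mk, ← map_smul]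
  congr 1
  funext x
  exact altStar_altStar (V := TangentSpace (𝓡 n) x) h h' finrank_euclideanSpace_fin
    (isUnitVolume_volForm o x) (a x)

/-- Supplies preimages under the star: its inverse is the star in the complementary degree, up to
sign. -/
theorem hodgeStar_smul_hodgeStar (o : ManifoldOrientation n M) {k l : ℕ} (h : k + l = n)
    (h' : l + k = n) (b : AEForm n M l) :
    hodgeStar o h (swapSign l k • hodgeStar o h' b) = b := by
  rw [map_smul, hodgeStar_hodgeStar, smul_smul, swapSign_mul_self, one_smul]

theorem hodgeStar_injective (o : ManifoldOrientation n M) {k l : ℕ} (h : k + l = n) :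
    Function.Injective (hodgeStar o h) := by
  have h' : l + k = n := by omega
  intro a b hab
  have h1 := congrArg (fun c => swapSign k l • hodgeStar o h' c) hab
  simpa only [hodgeStar_hodgeStar, smul_smul, swapSign_mul_self, one_smul] using h1

theorem lpENorm_hodgeStar (o : ManifoldOrientation n M) {k l : ℕ} (h : k + l = n) (p : ℝ)
    (a : AEForm n M k) : lpENorm p (hodgeStar o h a) = lpENorm p a := by
  obtain ⟨a, rfl⟩ := a.exists_mk
  simp only [hodgeStar_mk, lpENorm_mk, altNorm_altStar_volForm]

theorem IsLpForm.hodgeStar (o : ManifoldOrientation n M) {k l : ℕ} (h : k + l = n) {p : ℝ}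
    {a : AEForm n M k} (ha : IsLpForm p a) : IsLpForm p (hodgeStar o h a) := by
  refine ⟨?_, by rw [lpENorm_hodgeStar]; exact ha.2⟩
  obtain ⟨⟨a, ma, rfl⟩, -⟩ := ha
  exact ⟨_, ma.altStar o h, rfl⟩

theorem powForm_hodgeStar (o : ManifoldOrientation n M) {k l : ℕ} (h : k + l = n) (p : ℝ)
    (a : AEForm n M k) : powForm p (hodgeStar o h a) = hodgeStar o h (powForm p a) := by
  obtain ⟨a, rfl⟩ := a.exists_mk
  simp only [hodgeStar_mk, powForm_mk, altNorm_altStar_volForm, map_smul]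

/-! ### The power map and conjugate exponents -/

theorem altNorm_rpow_smul {V : Type*} [NormedAddCommGroup V] [InnerProductSpace ℝ V]
    [FiniteDimensional ℝ V] {k : ℕ} {p : ℝ} (hp : 1 < p) (α : V [⋀^Fin k]→ₗ[ℝ] ℝ) :
    altNorm (altNorm α ^ (p - 2) • α) = altNorm α ^ (p - 1) := by
  rw [altNorm_smul, abs_of_nonneg (Real.rpow_nonneg (altNorm_nonneg α) _)]
  -- At `α = 0` the value given to `0 ^ (p - 2)` is irrelevant, as it multiplies zero; the right
  -- side vanishes because `p - 1 ≠ 0`.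
  rcases (altNorm_nonneg α).eq_or_lt with h | h
  · rw [← h, mul_zero, Real.zero_rpow (by linarith)]
  · nth_rewrite 2 [← Real.rpow_one (altNorm α)]
    rw [← Real.rpow_add h]
    congr 1
    ring

theorem powForm_powForm {k : ℕ} {p : ℝ} (hp : 1 < p) (a : AEForm n M k) :
    powForm (p / (p - 1)) (powForm p a) = a := by
  obtain ⟨a, rfl⟩ := a.exists_mk
  rw [powForm_mk, powForm_mk]
  congr 1
  funext x
  simp only [altNorm_rpow_smul hp]
  rcases (altNorm_nonneg (a x)).eq_or_lt with h | h
  · rw [altNorm_eq_zero.1 h.symm, smul_zero, smul_zero]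
  · rw [smul_smul, ← Real.rpow_mul h.le, ← Real.rpow_add h]
    have hp1 : p - 1 ≠ 0 := by linarith
    -- The total exponent of `|a|`: since `(p - 1)p' = p`, it equals `p - 2(p - 1) + (p - 2)`.
    have : (p - 1) * (p / (p - 1) - 2) + (p - 2) = 0 := by
      field_simp
      ring
    rw [this, Real.rpow_zero, one_smul]

theorem one_lt_conjExponent {p : ℝ} (hp : 1 < p) : 1 < p / (p - 1) := by
  rw [one_lt_div (by linarith)]
  linarith

theorem conjExponent_conjExponent {p : ℝ} (hp : 1 < p) : p / (p - 1) / (p / (p - 1) - 1) = p := by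
  have hp1 : p - 1 ≠ 0 := by linarith
  have : p / (p - 1) - 1 = 1 / (p - 1) := by
    field_simp
    ring
  rw [this]
  field_simp

theorem powForm_conj_powForm {k : ℕ} {p : ℝ} (hp : 1 < p) (a : AEForm n M k) :
    powForm p (powForm (p / (p - 1)) a) = a := by
  have := powForm_powForm (one_lt_conjExponent hp) a
  rwa [conjExponent_conjExponent hp] at this

theorem lpENorm_rpow {k : ℕ} {p : ℝ} (hp : 0 < p) (a : DForm n M k) :
    lpENorm p (AEForm.mk a) ^ p = ∫⁻ x, ENNReal.ofReal (altNorm (a x)) ^ p ∂riemVol n M := by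
  rw [lpENorm_mk, ← ENNReal.rpow_mul, one_div_mul_cancel hp.ne', ENNReal.rpow_one]

/-- The integrands agree pointwise, by `(|a|^{p-1})^{p'} = |a|^p`. The equality holds in `[0, ∞]`,
so it also transfers finiteness. -/
theorem lpENorm_powForm {k : ℕ} {p : ℝ} (hp : 1 < p) (a : AEForm n M k) :
    lpENorm (p / (p - 1)) (powForm p a) ^ (p / (p - 1)) = lpENorm p a ^ p := by
  obtain ⟨a, rfl⟩ := a.exists_mk
  have hp1 : 0 < p - 1 := by linarith
  rw [powForm_mk, lpENorm_rpow (by positivity), lpENorm_rpow (by positivity)]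
  refine lintegral_congr fun x => ?_
  rw [altNorm_rpow_smul hp, ← ENNReal.ofReal_rpow_of_nonneg (altNorm_nonneg _) hp1.le,
    ← ENNReal.rpow_mul, mul_div_cancel₀ _ hp1.ne']

theorem IsLpForm.powForm [SecondCountableTopology M] {k : ℕ} {p : ℝ} (hp : 1 < p)
    {a : AEForm n M k} (ha : IsLpForm p a) : IsLpForm (p / (p - 1)) (powForm p a) := by
  have hp' : 0 < p / (p - 1) := by linarith [one_lt_conjExponent hp]
  refine ⟨?_, ?_⟩
  · obtain ⟨⟨a, ma, rfl⟩, -⟩ := ha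
    exact ⟨_, fun x₀ v => (((measurable_altNorm ma).pow_const (p - 2)).comp
      measurable_subtype_coe).mul (ma x₀ v), (powForm_mk p a).symm⟩
  · rw [← ENNReal.rpow_lt_top_iff_of_pos hp', lpENorm_powForm hp]
    exact ENNReal.rpow_lt_top_of_nonneg (by linarith) ha.2.ne

/-! ### Duality of the weak exterior derivative and the weak codifferential -/

theorem wedgeDensity_eq_altInner (o : ManifoldOrientation n M) {k m : ℕ} (h : k + m = n)
    (a : DForm n M k) (b : DForm n M m) :
    wedgeDensity o h a b = fun x => altInner (altStar h (volForm o x) (a x)) (b x) := by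
  funext x
  exact altInner_altWedge h (volForm o x) (a x) (b x)

theorem HasWeakCod.congr_ae {k : ℕ} {f f' : DForm n M (k + 1)} {g g' : DForm n M k}
    (h : HasWeakCod f g) (hf : ∀ᵐ x ∂riemVol n M, f x = f' x)
    (hg : ∀ᵐ x ∂riemVol n M, g x = g' x) : HasWeakCod f' g' := by
  intro φ hφ
  obtain ⟨h1, h2, h3⟩ := h φ hφ
  have e1 : (fun x => altInner (f x) (dForm φ x)) =ᵐ[riemVol n M]
      fun x => altInner (f' x) (dForm φ x) := hf.mono fun x hx => by simp only [hx]
  have e2 : (fun x => altInner (g x) (φ x)) =ᵐ[riemVol n M]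
      fun x => altInner (g' x) (φ x) := hg.mono fun x hx => by simp only [hx]
  exact ⟨h1.congr e1, h2.congr e2, by rw [← integral_congr_ae e1, h3, integral_congr_ae e2]⟩

/-- `WeakCod` only asks for some representatives; the integrals do not see null sets, so any
representatives will do. -/
theorem weakCod_mk_iff {k : ℕ} {f : DForm n M (k + 1)} {g : DForm n M k} :
    WeakCod (AEForm.mk f) (AEForm.mk g) ↔ HasWeakCod f g := by
  refine ⟨?_, fun h => ⟨f, g, rfl, rfl, h⟩⟩
  rintro ⟨f', g', hf, hg, h⟩
  exact h.congr_ae (AEForm.mk_eq_mk_iff.1 hf) (AEForm.mk_eq_mk_iff.1 hg)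

/-- Under `α ∧ β = ⟨⋆α, β⟩ τ` the two defining identities coincide test form by test form, once the
factor `(-1)^{k+1}` is absorbed into `g`. -/
theorem hasWeakD_iff_hasWeakCod (o : ManifoldOrientation n M) {k m : ℕ} (h : k + (m + 1) = n)
    (h' : k + 1 + m = n) (f : DForm n M k) (g : DForm n M (k + 1)) :
    HasWeakD o f g ↔ HasWeakCod (fun x => altStar h (volForm o x) (f x))
      ((-1 : ℝ) ^ (k + 1) • fun x => altStar h' (volForm o x) (g x)) := by
  have hc : ((-1 : ℝ) ^ (k + 1)) ≠ 0 := pow_ne_zero _ (by norm_num)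
  have key : ∀ ψ : DForm n M m,
      (Integrable (wedgeDensity o h f (dForm ψ)) (riemVol n M) ∧
        Integrable (wedgeDensity o h' g ψ) (riemVol n M) ∧
        ∫ x, wedgeDensity o h f (dForm ψ) x ∂riemVol n M
          = (-1) ^ (k + 1) * ∫ x, wedgeDensity o h' g ψ x ∂riemVol n M) ↔
      (Integrable (fun x => altInner (altStar h (volForm o x) (f x)) (dForm ψ x)) (riemVol n M) ∧
        Integrable (fun x => altInner (((-1 : ℝ) ^ (k + 1) •
          fun x => altStar h' (volForm o x) (g x) : DForm n M m) x) (ψ x)) (riemVol n M) ∧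
        ∫ x, altInner (altStar h (volForm o x) (f x)) (dForm ψ x) ∂riemVol n M
          = ∫ x, altInner (((-1 : ℝ) ^ (k + 1) •
            fun x => altStar h' (volForm o x) (g x) : DForm n M m) x) (ψ x) ∂riemVol n M) := by
    intro ψ
    simp only [wedgeDensity_eq_altInner, Pi.smul_apply, altInner_smul_left, integral_const_mul,
      integrable_const_mul_iff hc.isUnit]
  refine ⟨fun H ψ hψ => (key ψ).1 (H m h' ψ hψ), fun H m' hm' ψ hψ => ?_⟩
  -- The weak derivative is tested in every degree `m'` with `k + 1 + m' = n`, but there is only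
  -- one.
  obtain rfl : m' = m := by omega
  exact (key ψ).2 (H ψ hψ)

/-- The Hodge star turns `df = g` into `d^*(⋆f) = (-1)^{k+1} ⋆g`. -/
theorem weakD_iff_weakCod (o : ManifoldOrientation n M) {k m : ℕ} (h : k + (m + 1) = n)
    (h' : k + 1 + m = n) (f : AEForm n M k) (g : AEForm n M (k + 1)) :
    WeakD o f g ↔ WeakCod (hodgeStar o h f) ((-1 : ℝ) ^ (k + 1) • hodgeStar o h' g) := by
  constructor
  · rintro ⟨f', g', rfl, rfl, H⟩
    exact ⟨_, _, rfl, rfl, (hasWeakD_iff_hasWeakCod o h h' f' g').1 H⟩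
  · intro H
    obtain ⟨f', rfl⟩ := f.exists_mk
    obtain ⟨g', rfl⟩ := g.exists_mk
    rw [hodgeStar_mk, hodgeStar_mk, ← map_smul, weakCod_mk_iff] at H
    exact ⟨f', g', rfl, rfl, (hasWeakD_iff_hasWeakCod o h h' f' g').2 H⟩

theorem isClosedForm_iff_isCoclosedForm_hodgeStar (o : ManifoldOrientation n M) {k l : ℕ}
    (h : k + l = n) (f : AEForm n M k) :
    IsClosedForm o f ↔ IsCoclosedForm (hodgeStar o h f) := by
  cases l with
  | zero =>
    -- Here `k = n`: coclosedness in degree zero is no condition, and closedness is vacuous since no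
    -- test degree `m` satisfies `n + 1 + m = n`.
    refine ⟨fun _ => trivial, fun _ => ?_⟩
    obtain ⟨f', rfl⟩ := f.exists_mk
    exact ⟨f', 0, rfl, map_zero _, fun m hm => by omega⟩
  | succ m =>
    have := weakD_iff_weakCod o h (by omega) f 0
    rwa [map_zero, smul_zero] at this

theorem IsCoclosedForm.smul {k : ℕ} {f : AEForm n M k} (c : ℝ) (h : IsCoclosedForm f) :
    IsCoclosedForm (c • f) := by
  cases k with
  | zero => trivial
  | succ k =>
    have := WeakCod.smul c h
    rwa [smul_zero] at this

theorem isClosedForm_hodgeStar_iff (o : ManifoldOrientation n M) {k l : ℕ}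
    (h : k + l = n) (f : AEForm n M k) :
    IsClosedForm o (hodgeStar o h f) ↔ IsCoclosedForm f := by
  have h' : l + k = n := by omega
  rw [isClosedForm_iff_isCoclosedForm_hodgeStar o h', hodgeStar_hodgeStar]
  refine ⟨fun H => ?_, fun H => H.smul _⟩
  have := H.smul (swapSign k l)
  rwa [smul_smul, swapSign_mul_self, one_smul] at this

/-! ### The bijections between harmonic and coharmonic spaces -/

variable [SecondCountableTopology M]

/-- The two conditions trade places: `⋆_p h` is closed because `|h|^{p-2} h` is coclosed, and the
`p'`-power of `⋆_p h` is `⋆h`, which is coclosed because `h` is closed. -/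
theorem hodgeStarPow_mem_pHarmonic (o : ManifoldOrientation n M) {k l : ℕ} (hkl : k + l = n)
    {p : ℝ} (hp : 1 < p) {h : AEForm n M k} (hh : h ∈ pHarmonic o p k) :
    hodgeStarPow o hkl p h ∈ pHarmonic o (p / (p - 1)) l := by
  obtain ⟨h1, h2, h3⟩ := hh
  refine ⟨(h1.powForm hp).hodgeStar o hkl, (isClosedForm_hodgeStar_iff o hkl _).2 h3, ?_⟩
  rw [hodgeStarPow, powForm_hodgeStar, powForm_powForm hp]
  exact (isClosedForm_iff_isCoclosedForm_hodgeStar o hkl h).1 h2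

theorem IsLpForm.smul {k : ℕ} {p : ℝ} (hp : 1 ≤ p) {a : AEForm n M k} (c : ℝ)
    (ha : IsLpForm p a) : IsLpForm p (c • a) :=
  haveI : Fact (1 ≤ p) := ⟨hp⟩
  (LpForms n M p k).smul_mem c ha

theorem bijOn_hodgeStarPow (o : ManifoldOrientation n M) {k l : ℕ} (hkl : k + l = n)
    {p : ℝ} (hp : 1 < p) :
    BijOn (hodgeStarPow o hkl p) (pHarmonic o p k) (pHarmonic o (p / (p - 1)) l) := by
  refine ⟨fun h hh => hodgeStarPow_mem_pHarmonic o hkl hp hh, fun a _ b _ hab => ?_, ?_⟩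
  · have := congrArg (powForm (p / (p - 1))) (hodgeStar_injective o hkl hab)
    rwa [powForm_powForm hp, powForm_powForm hp] at this
  · intro g hg
    have hlk : l + k = n := by omega
    obtain ⟨h1, h2, h3⟩ := hg
    have hp' := one_lt_conjExponent hp
    -- The preimage undoes the star first and then the power map.
    refine ⟨powForm (p / (p - 1)) (swapSign l k • hodgeStar o hlk g), ⟨?_, ?_, ?_⟩, ?_⟩
    · have := ((h1.hodgeStar o hlk).smul hp'.le (swapSign l k)).powForm hp'
      rwa [conjExponent_conjExponent hp] at this
    · rw [isClosedForm_iff_isCoclosedForm_hodgeStar o hkl, ← powForm_hodgeStar,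
        hodgeStar_smul_hodgeStar]
      exact h3
    · rw [powForm_conj_powForm hp]
      exact ((isClosedForm_iff_isCoclosedForm_hodgeStar o hlk g).1 h2).smul _
    · rw [hodgeStarPow, powForm_conj_powForm hp, hodgeStar_smul_hodgeStar]

/-- With `g = |f|^{p-2} f` and `f = |g|^{p'-2} g`, the conditions on `f` and on `g` are the same two
conditions in the other order. -/
theorem bijOn_powForm (o : ManifoldOrientation n M) {p : ℝ} (hp : 1 < p) (k : ℕ) :
    BijOn (powForm p) (pCoharmonic o p k) (pHarmonic o (p / (p - 1)) k) := by
  refine ⟨?_, fun a _ b _ hab => ?_, ?_⟩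
  · rintro f ⟨h1, h2, h3⟩
    exact ⟨h1.powForm hp, h3, by rwa [powForm_powForm hp]⟩
  · have := congrArg (powForm (p / (p - 1))) hab
    rwa [powForm_powForm hp, powForm_powForm hp] at this
  · rintro g ⟨h1, h2, h3⟩
    refine ⟨powForm (p / (p - 1)) g, ⟨?_, h3, ?_⟩, powForm_conj_powForm hp g⟩
    · have := h1.powForm (one_lt_conjExponent hp)
      rwa [conjExponent_conjExponent hp] at this
    · rwa [powForm_conj_powForm hp]

/-! ### The star on `L_p` spaces and torsion -/

/-- The Hodge star as a linear isometry of `L_p` spaces. -/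
theorem exists_hodgeStar_linearIsometryEquiv (o : ManifoldOrientation n M) {k l : ℕ}
    (hkl : k + l = n) (p : ℝ) [Fact (1 ≤ p)] :
    ∃ S : LpForms n M p k ≃ₗᵢ[ℝ] LpForms n M p l,
      ∀ z : LpForms n M p k, (S z : AEForm n M l) = hodgeStar o hkl (z : AEForm n M k) := by
  have hlk : l + k = n := by omega
  let T : LpForms n M p k →ₗ[ℝ] LpForms n M p l :=
    (hodgeStar o hkl).restrict fun a ha => IsLpForm.hodgeStar o hkl ha
  have hT : Function.Bijective T := by
    refine ⟨fun a b hab => Subtype.ext (hodgeStar_injective o hkl (congrArg Subtype.val hab)),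
      fun w => ⟨⟨swapSign l k • hodgeStar o hlk w,
        (LpForms n M p k).smul_mem _ (IsLpForm.hodgeStar o hlk w.2)⟩, Subtype.ext ?_⟩⟩
    exact hodgeStar_smul_hodgeStar o hkl hlk w
  exact ⟨⟨LinearEquiv.ofBijective T hT, fun z =>
    congrArg ENNReal.toReal (lpENorm_hodgeStar o hkl p z)⟩, fun z => rfl⟩

/-- If `dβ = z`, then `⋆z = d^*((-1)^{k+1} ⋆β)`, and `⋆β` is again in `L_p`. Since `⋆` is onto in
both degrees, every element of `D_p` arises in this way. -/
theorem image_exactForms (o : ManifoldOrientation n M) {k l : ℕ} (hkl : k + l = n) (p : ℝ)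
    [Fact (1 ≤ p)] (S : LpForms n M p k ≃ₗᵢ[ℝ] LpForms n M p l)
    (hS : ∀ z : LpForms n M p k, (S z : AEForm n M l) = hodgeStar o hkl (z : AEForm n M k)) :
    S '' (exactForms o p k) = coexactForms n M p l := by
  cases k with
  | zero =>
    ext w
    constructor
    · rintro ⟨z, hz, rfl⟩
      obtain rfl : z = 0 := hz
      rw [map_zero]
      exact (coexactForms n M p l).zero_mem
    · rintro ⟨hw, -⟩
      -- In degree `k = 0` one has `l = n`, where the explicit clause in `coexactForms` makes that
      -- space zero, to match `B_p^0 = 0`.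
      rw [hw (by omega)]
      exact ⟨0, (exactForms o p 0).zero_mem, map_zero S⟩
  | succ k =>
    have hk : k + (l + 1) = n := by omega
    have hc : (-1 : ℝ) ^ (k + 1) * (-1 : ℝ) ^ (k + 1) = 1 := by
      rw [← mul_pow]; norm_num
    obtain ⟨R, hR⟩ := exists_hodgeStar_linearIsometryEquiv o hk p
    ext w
    constructor
    · rintro ⟨z, ⟨β, hβ⟩, rfl⟩
      refine ⟨fun h => by omega, (-1 : ℝ) ^ (k + 1) • R β, ?_⟩
      have := ((weakD_iff_weakCod o hk hkl _ _).1 hβ).smul ((-1 : ℝ) ^ (k + 1))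
      rwa [smul_smul, hc, one_smul, ← hR, ← hS] at this
    · rintro ⟨-, γ, hγ⟩
      obtain ⟨β, rfl⟩ := R.surjective γ
      obtain ⟨z, rfl⟩ := S.surjective w
      -- The primitive carries the sign, so that `d^*` of its star is `(-1)^{k+1} ⋆z`, the form the
      -- duality requires.
      refine ⟨z, ⟨(-1 : ℝ) ^ (k + 1) • β, ?_⟩, rfl⟩
      have := hγ.smul ((-1 : ℝ) ^ (k + 1))
      rw [hR, hS, ← map_smul] at this
      exact (weakD_iff_weakCod o hk hkl _ _).2 this

set_option maxHeartbeats 2000000 in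
/-- The Hodge star identifies torsion cohomology with torsion homology. -/
theorem exists_hodgeStar_torsion (o : ManifoldOrientation n M) {k l : ℕ} (hkl : k + l = n)
    (p : ℝ) [Fact (1 ≤ p)] :
    ∃ S : LpForms n M p k ≃ₗᵢ[ℝ] LpForms n M p l,
      (∀ z : LpForms n M p k, (S z : AEForm n M l) = hodgeStar o hkl (z : AEForm n M k)) ∧
      S '' (exactForms o p k) = coexactForms n M p l ∧
      S '' (exactForms o p k).topologicalClosure = (coexactForms n M p l).topologicalClosure ∧
      ∃ Φ : TorsionCohomology o p k ≃ₗᵢ[ℝ] TorsionHomology n M p l,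
        ∀ (z : (exactForms o p k).topologicalClosure)
          (w : (coexactForms n M p l).topologicalClosure),
          S z = w → Φ (Submodule.Quotient.mk z) = Submodule.Quotient.mk w := by
  obtain ⟨S, hS⟩ := exists_hodgeStar_linearIsometryEquiv o hkl p
  have himage := image_exactForms o hkl p S hS
  exact ⟨S, hS, himage, exists_closure_quotient_linearIsometryEquiv S _ _ himage⟩

end Manifold

end

theorem mainTheorem9 {n : ℕ} {M : Type*} [EMetricSpace M]
    [ChartedSpace (EuclideanSpace ℝ (Fin n)) M] [IsManifold (𝓡 n) ∞ M]
    [RiemannianBundle (fun x : M => TangentSpace (𝓡 n) x)]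
    [IsContMDiffRiemannianBundle (𝓡 n) ∞ (EuclideanSpace ℝ (Fin n))
      (fun x : M => TangentSpace (𝓡 n) x)]
    [IsRiemannianManifold (𝓡 n) M] [CompleteSpace M] [SecondCountableTopology M]
    [MeasurableSpace M] [BorelSpace M]
    (o : ManifoldOrientation n M) (p : ℝ) [Fact (1 < p)] (k l : ℕ) (hkl : k + l = n) :
    (BijOn (hodgeStarPow o hkl p) (pHarmonic o p k) (pHarmonic o (p / (p - 1)) l) ∧
      ∀ h ∈ pHarmonic o p k,
        lpENorm (p / (p - 1)) (hodgeStarPow o hkl p h) ^ (p / (p - 1)) = lpENorm p h ^ p) ∧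
    (BijOn (powForm p) (pCoharmonic o p k) (pHarmonic o (p / (p - 1)) k) ∧
      ∀ h ∈ pCoharmonic o p k,
        lpENorm (p / (p - 1)) (powForm p h) ^ (p / (p - 1)) = lpENorm p h ^ p) ∧
    ∃ S : LpForms n M p k ≃ₗᵢ[ℝ] LpForms n M p l,
      (∀ z : LpForms n M p k, (S z : AEForm n M l) = hodgeStar o hkl (z : AEForm n M k)) ∧
      S '' (exactForms o p k) = coexactForms n M p l ∧
      S '' (exactForms o p k).topologicalClosure = (coexactForms n M p l).topologicalClosure ∧
      ∃ Φ : TorsionCohomology o p k ≃ₗᵢ[ℝ] TorsionHomology n M p l,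
        ∀ (z : (exactForms o p k).topologicalClosure)
          (w : (coexactForms n M p l).topologicalClosure),
          S z = w → Φ (Submodule.Quotient.mk z) = Submodule.Quotient.mk w := by
  have hp : 1 < p := Fact.out
  refine ⟨⟨bijOn_hodgeStarPow o hkl hp, fun h _ => ?_⟩, ⟨bijOn_powForm o hp k,
    fun h _ => lpENorm_powForm hp h⟩, exists_hodgeStar_torsion o hkl p⟩
  rw [hodgeStarPow, lpENorm_hodgeStar, lpENorm_powForm hp]
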